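/- Fix an integer $t\ge 1$; put $\ell=2$ and $[a]=\{0,\dots,a-1\}$. There are $n\ge1$ binary cells. Let $v\in[\ell+1]^n$ be the cell-program-count vector (how often each cell was programmed, initially $0$); the cell-state vector is $\langle v\rangle_2=v \bmod 2$. Attempting to program $c\in[2]^n$ when the counts are $v$ gives the count vector $N(v,c)$ with $N(v,c)_k=v_k$ if $c_k\equiv v_k \pmod 2$ and $N(v,c)_k=\min\{\ell,v_k+1\}$ otherwise, and the state vector $f(v,c)=\langle N(v,c)\rangle_2$. A $t$-write code of the model $EX{:}DY$, with $X,Y\in\{IA,IP,U\}$ and $M_1,\dots,M_t$ messages, consists for each write $j$ of an encoder, which maps a message $m\in[M_j]$ and the information $X$ on the current count vector $v$ to a word $c\in[2]^n$, and a decoder, which maps the new state vector $f(v,c)$ and the information $Y$ on $v$ to an element of $[M_j]$. The information is $v$ for $IA$, $\langle v\rangle_2$ for $IP$, and nothing for $U$. For $X=IA$ the encoder must never try to program a cell that has already been programmed $\ell$ times. The messages are independent and uniformly distributed, and $p_{e_j}$ is the probability that the decoder errs on write $j$. The $\varepsilon$-error capacity region $\mathcal C^{EX:DY,\varepsilon}_{t,\ell}$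 is the set of all $(R_1,\dots,R_t)\in\mathbb R^t$ such that for every $\varepsilon>0$ there is a code (for some $n\ge1$) with $p_{e_j}\le\varepsilon$ and $\frac1n\log_2 M_j\ge R_j-\varepsilon$ for all $j$; the zero-error region $\mathcal C^{EX:DY,z}_{t,\ell}$ is defined in the same way with $p_{e_j}=0$. Let $h$ be the binary entropy function in bits. Let $\mathcal C_{t,\ell}$ be the set of all $(R_1,\dots,R_t)\in\mathbb R^t$ for which there are numbers $p_{j,i}\in[0,\frac12]$ ($1\le j\le t$, $0\le i\le\ell$), with $p_{j,\ell}=0$ for all $j$ and $p_{j,j}=0$ for $j\le\ell$, such that for all $1\le j\le t$ $$R_j\le\sum_{i=0}^{\min\{\ell,j\}-1}Q_{j-1,i}\,h(p_{j,i}),$$ where $Q_{0,0}=1$, $Q_{0,i}=0$ for $i>0$, $Q_{j,0}=Q_{j-1,0}(1-p_{j,0})$ and $Q_{j,i}=Q_{j-1,i}(1-p_{j,i})+Q_{j-1,i-1}p_{j,i-1}$ for $i>0$. Let $\widetilde{\mathcal C}_{t,2}$ be the set of all $(R_1,\dots,R_t)\in\mathbb R^t$ for which there are $p_{j,0},p_{j,1}\in[0,\frac12]$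 ($1\le j\le t$) such that for all $1\le j\le t$ $$R_j\le Q_{j-1,o}\,h(p_{j,1})+(Q_{j-1,e}-Q_{j-1,2})\,h(p_{j,0}),$$ where $Q_{0,0}=1$, $Q_{0,1}=Q_{0,2}=0$, $Q_{j,0}=Q_{j-1,0}(1-p_{j,0})$, $Q_{j,1}=Q_{j-1,0}\,p_{j,0}+Q_{j-1,1}(1-p_{j,1})$, $Q_{j,2}=Q_{j-1,1}\,p_{j,1}+Q_{j-1,2}$, $Q_{j,e}=Q_{j,0}+Q_{j,2}$ and $Q_{j,o}=Q_{j,1}$. **Theorem.** For $\ell=2$, the $\varepsilon$-error capacity region of the EIP:DIA model equals the capacity region $\mathcal C^{EIA}_{t,2}$ of the EIA models, that is, for every $Y\in\{IA,IP,U\}$, $$\mathcal C^{EIP:DIA,\varepsilon}_{t,2}=\mathcal C^{EIA:DY,\varepsilon}_{t,2}=\mathcal C^{EIA:DY,z}_{t,2},$$ and this common region is $\mathcal C_{t,2}$. Moreover, the two defining regions coincide: $\widetilde{\mathcal C}_{t,2}=\mathcal C_{t,2}$. -/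

import Mathlib

namespace ELM

/-- What an encoder or a decoder knows about the memory before a write: the number of times each
cell was programmed (informed all), only the binary state of each cell (informed partially), or
nothing (uninformed). -/
inductive Knowledge where
  | IA
  | IP
  | U

/-- Cell-state vectors, `[2]^n`. -/
abbrev State (n : ℕ) : Type := Fin n → Fin 2

/-- Cell-program-count vectors, `[ℓ+1]^n`. -/
abbrev Count (n ℓ : ℕ) : Type := Fin n → Fin (ℓ + 1)

/-- The vector `v` modulo 2: a cell's state is the parity of its number of programmings. -/
def parity {n ℓ : ℕ} (v : Count n ℓ) : State n :=
  fun k => ⟨(v k : ℕ) % 2, Nat.mod_lt _ Nat.two_pos⟩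

/-- `N(v, c)`: the new cell-program-count vector after attempting to program `c` when the count
vector is `v`; a cell already programmed `ℓ` times does not change. -/
def newCount {n ℓ : ℕ} (v : Count n ℓ) (c : State n) : Count n ℓ :=
  fun k => if c k = parity v k then v k
    else ⟨min ℓ ((v k : ℕ) + 1), Nat.lt_succ_of_le (Nat.min_le_left _ _)⟩

/-- `f(v, c)`: the new cell-state vector after attempting to program `c`. -/
def newState {n ℓ : ℕ} (v : Count n ℓ) (c : State n) : State n :=
  fun k => if (v k : ℕ) < ℓ then c k else parity v k

/-- Programming `c` on `v` exceeds the limit `ℓ` in no cell: `v + (⟨v⟩₂ ⊕ c) ∈ [ℓ+1]^n`. -/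
def Admissible {n ℓ : ℕ} (v : Count n ℓ) (c : State n) : Prop :=
  ∀ k, (v k : ℕ) + (if c k = parity v k then 0 else 1) ≤ ℓ

/-- For an admissible write the stored word is exactly the word chosen by the encoder, so feeding
the decoder with `newState v c` agrees, in the EIA models, with feeding it with `c`. -/
theorem newState_eq_of_admissible {n ℓ : ℕ} {v : Count n ℓ} {c : State n}
    (h : Admissible v c) : newState v c = c := by
  funext k
  have hk := h k
  unfold newState
  split_ifs with h1
  · rfl
  · by_contra h2
    rw [if_neg (fun h3 => h2 h3.symm)] at hk
    omega

/-- The type of the information on the memory that is available at knowledge level `X`. -/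
def View : Knowledge → ℕ → ℕ → Type
  | .IA, n, ℓ => Count n ℓ
  | .IP, n, _ => State n
  | .U, _, _ => Unit

/-- The information on the count vector `v` that is available at knowledge level `X`. -/
def view : (X : Knowledge) → {n ℓ : ℕ} → Count n ℓ → View X n ℓ
  | .IA, _, _, v => v
  | .IP, _, _, v => parity v
  | .U, _, _, _ => ()

/-- Encoding maps for `t` writes, with `M j` messages on write `j`. (They are total functions;
only their values at views of vectors in the sets `countSet` below play a role.) -/
abbrev Encoders (X : Knowledge) (n t ℓ : ℕ) (M : Fin t → ℕ) : Type :=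
  ∀ j : Fin t, Fin (M j) → View X n ℓ → State n

open Classical in
/-- The sets `N_0, …, N_t`: `N_0 = {0}`, and `N_{j+1}` consists of all `N(v, c)` with `v ∈ N_j`
and `c` in the image of the encoding map of the `(j+1)`-st write, whose domain is made of the
messages and the views of the elements of `N_j`. -/
noncomputable def countSet {X : Knowledge} {n t ℓ : ℕ} {M : Fin t → ℕ}
    (E : Encoders X n t ℓ M) : Fin (t + 1) → Finset (Count n ℓ) :=
  Fin.induction (motive := fun _ => Finset (Count n ℓ)) {0} (fun j N =>
    Finset.image₂ newCount N
      (Finset.image₂ (fun (m : Fin (M j)) v => E j m (view X v)) Finset.univ N))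

open Classical in
/-- `stateProb E j v` is the probability that the count vector after the first `j` writes is `v`,
when the messages of the writes are independent and uniformly distributed. -/
noncomputable def stateProb {X : Knowledge} {n t ℓ : ℕ} {M : Fin t → ℕ}
    (E : Encoders X n t ℓ M) : Fin (t + 1) → Count n ℓ → ℝ :=
  Fin.induction (motive := fun _ => Count n ℓ → ℝ) (fun v => if v = 0 then 1 else 0)
    (fun j P w => ∑ m : Fin (M j), ∑ v : Count n ℓ,
      if newCount v (E j m (view X v)) = w then 1 / (M j : ℝ) * P v else 0)

/-- An `ℓ`-change `t`-write ELM code of the model `EX:DY` on `n` cells with `M j` messages on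
write `j` (writes are numbered from `0`). In the EIA models the encoder never tries to program a
cell that was already programmed `ℓ` times. The decoder receives the new cell-state vector and its
information on the count vector before the write. (Since the decoder takes values in
`Fin (M j)`, every `M j` is positive.) -/
structure Code (X Y : Knowledge) (n t ℓ : ℕ) (M : Fin t → ℕ) where
  enc : Encoders X n t ℓ M
  dec : ∀ j : Fin t, State n → View Y n ℓ → Fin (M j)
  admissible : X = Knowledge.IA → ∀ (j : Fin t) (m : Fin (M j)),
    ∀ v ∈ countSet enc j.castSucc, Admissible v (enc j m (view X v))

open Classical in
/-- The probability of a decoding error on write `j`, i.e. the sum of `Pr(m) Pr(v)` over the pairs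
`(m, v)` of a message and a count vector before the write for which decoding fails. -/
noncomputable def Code.errorProb {X Y : Knowledge} {n t ℓ : ℕ} {M : Fin t → ℕ}
    (C : Code X Y n t ℓ M) (j : Fin t) : ℝ :=
  ∑ m : Fin (M j), ∑ v ∈ countSet C.enc j.castSucc,
    1 / (M j : ℝ) * stateProb C.enc j.castSucc v *
      (if C.dec j (newState v (C.enc j m (view X v))) (view Y v) = m then 0 else 1)

/-- The `ε`-error capacity region of the model `EX:DY`: all rate tuples such that for each
`ε > 0` some code has error probability at most `ε` and rate at least `R j - ε` on each write. -/
def epsCapacity (X Y : Knowledge) (t ℓ : ℕ) : Set (Fin t → ℝ) :=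
  {R | ∀ ε : ℝ, 0 < ε → ∃ (n : ℕ) (M : Fin t → ℕ) (C : Code X Y n t ℓ M), 0 < n ∧
    ∀ j, C.errorProb j ≤ ε ∧ R j - ε ≤ Real.logb 2 (M j) / n}

/-- The zero-error capacity region of the model `EX:DY`. -/
def zeroCapacity (X Y : Knowledge) (t ℓ : ℕ) : Set (Fin t → ℝ) :=
  {R | ∀ ε : ℝ, 0 < ε → ∃ (n : ℕ) (M : Fin t → ℕ) (C : Code X Y n t ℓ M), 0 < n ∧
    ∀ j, C.errorProb j = 0 ∧ R j - ε ≤ Real.logb 2 (M j) / n}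

/-- The binary entropy function, in bits. -/
noncomputable def h (p : ℝ) : ℝ := Real.binEntropy p / Real.log 2

/-- The probability `Q_{j,i}` that a cell has been programmed exactly `i` times on the first `j`
writes, where `p j i` is the probability of programming on write `j` (numbered from `1`) a cell
that was programmed `i` times. -/
def Q (p : ℕ → ℕ → ℝ) : ℕ → ℕ → ℝ
  | 0, 0 => 1
  | 0, _ + 1 => 0
  | j + 1, 0 => Q p j 0 * (1 - p (j + 1) 0)
  | j + 1, i + 1 => Q p j (i + 1) * (1 - p (j + 1) (i + 1)) + Q p j i * p (j + 1) i

/-- The region `C_{t,ℓ}` of the EIA models. The coordinate `R j` is the rate of the write with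
number `j + 1`. -/
def regionEIA (t ℓ : ℕ) : Set (Fin t → ℝ) :=
  {R | ∃ p : ℕ → ℕ → ℝ,
    (∀ j ∈ Set.Icc 1 t, (∀ i < ℓ, p j i ∈ Set.Icc (0 : ℝ) (1 / 2)) ∧ p j j = 0 ∧ p j ℓ = 0) ∧
    ∀ j : Fin t, R j ≤ ∑ i ∈ Finset.range (min ℓ ((j : ℕ) + 1)), Q p j i * h (p (j + 1) i)}

/-- The probability that a cell has been programmed exactly `i` times, `0 ≤ i ≤ ℓ`, on the first
`j` writes, when `p j k` is the probability of trying to program on write `j` (numbered from `1`) a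
cell of state `k ∈ {0, 1}`, and a cell programmed `ℓ` times is frozen. -/
def Qtilde (ℓ : ℕ) (p : ℕ → ℕ → ℝ) : ℕ → ℕ → ℝ
  | 0, 0 => 1
  | 0, _ + 1 => 0
  | j + 1, 0 => Qtilde ℓ p j 0 * (1 - p (j + 1) 0)
  | j + 1, i + 1 =>
      if i + 1 < ℓ then
        Qtilde ℓ p j i * p (j + 1) (i % 2) + Qtilde ℓ p j (i + 1) * (1 - p (j + 1) ((i + 1) % 2))
      else if i + 1 = ℓ then
        Qtilde ℓ p j i * p (j + 1) (i % 2) + Qtilde ℓ p j (i + 1)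
      else 0

/-- The probability that a cell was programmed an even number of times on the first `j` writes. -/
def Qeven (ℓ : ℕ) (p : ℕ → ℕ → ℝ) (j : ℕ) : ℝ :=
  ∑ i ∈ Finset.range (ℓ + 1) with Even i, Qtilde ℓ p j i

/-- The probability that a cell was programmed an odd number of times on the first `j` writes. -/
def Qodd (ℓ : ℕ) (p : ℕ → ℕ → ℝ) (j : ℕ) : ℝ :=
  ∑ i ∈ Finset.range (ℓ + 1) with Odd i, Qtilde ℓ p j i

/-- The region of the EIP:DIA model; the frozen cells are even for even `ℓ`, odd for odd `ℓ`. -/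
def regionEIPDIA (t ℓ : ℕ) : Set (Fin t → ℝ) :=
  {R | ∃ p : ℕ → ℕ → ℝ,
    (∀ j ∈ Set.Icc 1 t, p j 0 ∈ Set.Icc (0 : ℝ) (1 / 2) ∧ p j 1 ∈ Set.Icc (0 : ℝ) (1 / 2)) ∧
    ∀ j : Fin t, R j ≤
      if Even ℓ then
        Qodd ℓ p j * h (p (j + 1) 1) + (Qeven ℓ p j - Qtilde ℓ p j ℓ) * h (p (j + 1) 0)
      else
        (Qodd ℓ p j - Qtilde ℓ p j ℓ) * h (p (j + 1) 1) + Qeven ℓ p j * h (p (j + 1) 0)}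

end ELM

namespace ELM

/-! All the regions equal `rateRegion`, in which a write stores the entropy of programming each
fresh cell with probability `a j` and each once-programmed cell with probability `b j`. For ℓ = 2
the state of a live cell determines its count (state 0 means fresh, state 1 means once programmed).
Hence an encoder that sees only states can still choose the right programming probability. It merely
cannot tell frozen cells from fresh ones, and frozen cells never change.

Converse, for every kind of encoder and decoder: fix the count vector. Fano's inequality and
subadditivity bound the logarithm of the number of messages by the sum of the entropies of the
cells' change probabilities (`log_card_le`). Averaging over count vectors and applying Jensen to all
cells of equal count leaves the mean fractions of fresh and once-programmed cells, which obey the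
recursion of `fresh` with probabilities in [0, 1]. These are brought into [0, 1/2] by a domination
argument (`exists_imitation`): a memory with more fresh cells and more live cells can imitate the
write and stay ahead. The region is closed by compactness, so ε can tend to 0.

Achievability rests on typicality: a count vector is typical if its numbers of fresh and
once-programmed cells are nearly as prescribed, and a balanced word preserves this up to a larger
tolerance. If the encoder knows the counts, each typical vector has exponentially many balanced
admissible words, and a random colouring of all words shows every colour among them. The colour is
the message, so no error occurs and the decoder needs no information
(`eventually_exists_zero_error_write`). If the encoder knows only the states and the decoder knows
the counts, a random codebook is drawn for each state vector. Two codewords are confused only if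
they agree on all live cells, which is exponentially unlikely, and an averaging argument fixes the
codebooks (`eventually_exists_small_error_write`). -/

/-- The fractions of cells that were programmed never and exactly once before write `j` (writes are
numbered from `0`), when `a j` and `b j` are the programming probabilities of these cells. -/
def fresh (a b : ℕ → ℝ) : ℕ → ℝ × ℝ
  | 0 => (1, 0)
  | j + 1 => ((fresh a b j).1 * (1 - a j), (fresh a b j).2 * (1 - b j) + (fresh a b j).1 * a j)

/-- The rate of write `j` for the programming probabilities `a` and `b`. -/
noncomputable def rate (a b : ℕ → ℝ) (j : ℕ) : ℝ :=
  (fresh a b j).1 * h (a j) + (fresh a b j).2 * h (b j)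

/-- Both defining regions in terms of `rate`. -/
def rateRegion (t : ℕ) : Set (Fin t → ℝ) :=
  {R | ∃ a b : ℕ → ℝ, (∀ j, a j ∈ Set.Icc (0 : ℝ) (1 / 2)) ∧ (∀ j, b j ∈ Set.Icc (0 : ℝ) (1 / 2)) ∧
    ∀ j : Fin t, R j ≤ rate a b j}

/-! ### The two defining regions as one rate region -/

/-- The value `b 0` is immaterial because no cell has been programmed before the first write. This
is what reconciles the constraint p_{1,1} = 0 of one region with its absence in the other. -/
theorem fresh_congr {a b a' b' : ℕ → ℝ} {j : ℕ} (ha : ∀ i < j, a i = a' i)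
    (hb : ∀ i < j, i ≠ 0 → b i = b' i) : fresh a b j = fresh a' b' j := by
  induction j with
  | zero => rfl
  | succ j ih =>
    have ih := ih (fun i hi => ha i (by omega)) (fun i hi => hb i (by omega))
    rw [fresh, fresh, ih, ha j (by omega)]
    rcases eq_or_ne j 0 with rfl | hj
    · simp [fresh]
    · rw [hb j (by omega) hj]

theorem rate_congr {a b a' b' : ℕ → ℝ} {j : ℕ} (ha : ∀ i ≤ j, a i = a' i)
    (hb : ∀ i ≤ j, i ≠ 0 → b i = b' i) : rate a b j = rate a' b' j := by
  rw [rate, rate, fresh_congr (fun i hi => ha i hi.le) (fun i hi => hb i hi.le), ha j le_rfl]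
  rcases eq_or_ne j 0 with rfl | hj
  · simp [fresh]
  · rw [hb j le_rfl hj]

theorem mem_rateRegion_of_forall_lt {t : ℕ} {R : Fin t → ℝ} {a b : ℕ → ℝ}
    (ha : ∀ j < t, a j ∈ Set.Icc (0 : ℝ) (1 / 2))
    (hb : ∀ j < t, j ≠ 0 → b j ∈ Set.Icc (0 : ℝ) (1 / 2))
    (hR : ∀ j : Fin t, R j ≤ rate a b j) : R ∈ rateRegion t := by
  refine ⟨fun j => if j < t then a j else 0, fun j => if j < t ∧ j ≠ 0 then b j else 0, ?_, ?_, ?_⟩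
  · intro j
    dsimp only
    split_ifs with hj
    · exact ha j hj
    · norm_num
  · intro j
    dsimp only
    split_ifs with hj
    · exact hb j hj.1 hj.2
    · norm_num
  · intro j
    refine (hR j).trans (rate_congr ?_ ?_).le
    · intro i hi
      rw [if_pos (by omega)]
    · intro i hi h0
      rw [if_pos ⟨by omega, h0⟩]

theorem Q_eq_fresh (p : ℕ → ℕ → ℝ) (j : ℕ) :
    Q p j 0 = (fresh (fun j => p (j + 1) 0) (fun j => p (j + 1) 1) j).1 ∧
    Q p j 1 = (fresh (fun j => p (j + 1) 0) (fun j => p (j + 1) 1) j).2 := by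
  induction j with
  | zero => simp [Q, fresh]
  | succ j ih => simp [Q, fresh, ih.1, ih.2]

theorem sum_Q_eq_rate (p : ℕ → ℕ → ℝ) (j : ℕ) :
    ∑ i ∈ Finset.range (min 2 (j + 1)), Q p j i * h (p (j + 1) i) =
      rate (fun j => p (j + 1) 0) (fun j => p (j + 1) 1) j := by
  rcases j with _ | j
  · simp [rate, fresh, Q]
  · rw [min_eq_left (by omega), Finset.sum_range_succ, Finset.sum_range_one, (Q_eq_fresh p _).1,
      (Q_eq_fresh p _).2, rate]

theorem regionEIA_eq (t : ℕ) : regionEIA t 2 = rateRegion t := by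
  ext R
  constructor
  · rintro ⟨p, hp, hR⟩
    refine mem_rateRegion_of_forall_lt (a := fun j => p (j + 1) 0) (b := fun j => p (j + 1) 1)
      (fun j hj => (hp (j + 1) ⟨by omega, by omega⟩).1 0 (by norm_num))
      (fun j hj _ => (hp (j + 1) ⟨by omega, by omega⟩).1 1 (by norm_num)) fun j => ?_
    exact (hR j).trans (sum_Q_eq_rate p j).le
  · rintro ⟨a, b, ha, hb, hR⟩
    -- The shift `j - 1` passes from writes numbered from 1 to writes numbered from 0. Excluding `j
    -- = 1` secures p_{1,1} = 0.
    refine ⟨fun j i => if i = 0 then a (j - 1) else if i = 1 ∧ j ≠ 1 then b (j - 1) else 0, ?_, ?_⟩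
    · rintro j ⟨hj, -⟩
      refine ⟨fun i _ => ?_, ?_, by simp⟩
      · dsimp only
        split_ifs
        · exact ha _
        · exact hb _
        · norm_num
      · dsimp only
        rw [if_neg (by omega), if_neg (by omega)]
    · intro j
      rw [sum_Q_eq_rate]
      refine (hR j).trans (rate_congr ?_ ?_).le
      · intro i _
        simp
      · intro i _ hi
        simp [hi]

theorem Qtilde_eq_fresh (p : ℕ → ℕ → ℝ) (j : ℕ) :
    Qtilde 2 p j 0 = (fresh (fun j => p (j + 1) 0) (fun j => p (j + 1) 1) j).1 ∧
    Qtilde 2 p j 1 = (fresh (fun j => p (j + 1) 0) (fun j => p (j + 1) 1) j).2 := by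
  induction j with
  | zero => simp [Qtilde, fresh]
  | succ j ih => simp [Qtilde, fresh, ih.1, ih.2, add_comm]

theorem regionEIPDIA_eq (t : ℕ) : regionEIPDIA t 2 = rateRegion t := by
  have key : ∀ (p : ℕ → ℕ → ℝ) (j : ℕ),
      (if Even 2 then
        Qodd 2 p j * h (p (j + 1) 1) + (Qeven 2 p j - Qtilde 2 p j 2) * h (p (j + 1) 0)
      else
        (Qodd 2 p j - Qtilde 2 p j 2) * h (p (j + 1) 1) + Qeven 2 p j * h (p (j + 1) 0)) =
      rate (fun j => p (j + 1) 0) (fun j => p (j + 1) 1) j := by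
    intro p j
    have h1 : Qodd 2 p j = Qtilde 2 p j 1 := by
      rw [Qodd, show (Finset.range (2 + 1)).filter (fun i => Odd i) = {1} by decide,
        Finset.sum_singleton]
    have h2 : Qeven 2 p j = Qtilde 2 p j 0 + Qtilde 2 p j 2 := by
      rw [Qeven, show (Finset.range (2 + 1)).filter (fun i => Even i) = {0, 2} by decide,
        Finset.sum_pair (by decide)]
    rw [if_pos (by decide), h1, h2, (Qtilde_eq_fresh p j).2, (Qtilde_eq_fresh p j).1, rate]
    ring
  ext R
  constructor
  · rintro ⟨p, hp, hR⟩
    refine mem_rateRegion_of_forall_lt (a := fun j => p (j + 1) 0) (b := fun j => p (j + 1) 1)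
      (fun j hj => (hp (j + 1) ⟨by omega, by omega⟩).1)
      (fun j hj _ => (hp (j + 1) ⟨by omega, by omega⟩).2) fun j => ?_
    exact (hR j).trans (key p j).le
  · rintro ⟨a, b, ha, hb, hR⟩
    refine ⟨fun j i => if i = 0 then a (j - 1) else b (j - 1), ?_, ?_⟩
    · rintro j -
      exact ⟨ha (j - 1), hb (j - 1)⟩
    · intro j
      rw [key]
      simpa using hR j

/-! ### Concavity of entropy and restriction to probabilities at most 1/2 -/

theorem h_zero : h 0 = 0 := by simp [h]

theorem h_continuous : Continuous h := Real.binEntropy_continuous.div_const _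

theorem h_one_sub (p : ℝ) : h (1 - p) = h p := by simp [h]

theorem concaveOn_h : ConcaveOn ℝ (Set.Icc 0 1) h := by
  have e : h = fun p => (Real.log 2)⁻¹ • Real.binEntropy p := by
    ext p
    simp [h, div_eq_inv_mul]
  rw [e]
  exact Real.strictConcave_binEntropy.concaveOn.smul
    (inv_nonneg.mpr (Real.log_nonneg (by norm_num : (1 : ℝ) ≤ 2)))

theorem h_min (p : ℝ) : h (min p (1 - p)) = h p := by
  rcases min_choice p (1 - p) with e | e <;> rw [e]
  exact h_one_sub p

/-- Jensen's inequality for `h` with two masses inside a larger total mass. -/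
theorem h_merge {u v w p q : ℝ} (hu : 0 ≤ u) (hv : 0 ≤ v) (hw : u + v ≤ w)
    (hp : p ∈ Set.Icc (0 : ℝ) 1) (hq : q ∈ Set.Icc (0 : ℝ) 1) :
    u * h p + v * h q ≤ w * h ((u * p + v * q) / w) := by
  rcases eq_or_lt_of_le (show 0 ≤ w by linarith) with rfl | hw0
  · have hu' : u = 0 := by linarith
    have hv' : v = 0 := by linarith
    simp [hu', hv']
  · have hsum : u / w + v / w + (w - u - v) / w = 1 := by field_simp; ring
    -- The unused mass w - u - v is given the point 0, where `h` vanishes.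
    have := concaveOn_h.le_map_sum (t := Finset.univ) (w := ![u / w, v / w, (w - u - v) / w])
      (p := ![p, q, 0])
      (by
        intro i _
        fin_cases i
        · exact div_nonneg hu hw0.le
        · exact div_nonneg hv hw0.le
        · exact div_nonneg (by linarith) hw0.le)
      (by simpa [Fin.sum_univ_three] using hsum)
      (by
        intro i _
        fin_cases i
        · exact hp
        · exact hq
        · norm_num)
    simp only [Fin.sum_univ_three, smul_eq_mul, Matrix.cons_val_zero, Matrix.cons_val_one,
      Matrix.cons_val, mul_zero, add_zero, h_zero] at this
    have e : u / w * p + v / w * q = (u * p + v * q) / w := by field_simp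
    rw [e] at this
    calc u * h p + v * h q = w * (u / w * h p + v / w * h q) := by field_simp
      _ ≤ _ := mul_le_mul_of_nonneg_left this hw0.le

theorem merge_mem {u v w p q : ℝ} (hu : 0 ≤ u) (hv : 0 ≤ v) (hw : u + v ≤ w)
    (hp : p ∈ Set.Icc (0 : ℝ) (1 / 2)) (hq : q ∈ Set.Icc (0 : ℝ) (1 / 2)) :
    (u * p + v * q) / w ∈ Set.Icc (0 : ℝ) (1 / 2) := by
  have hw0 : 0 ≤ w := by linarith
  refine ⟨div_nonneg (add_nonneg (mul_nonneg hu hp.1) (mul_nonneg hv hq.1)) hw0, ?_⟩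
  refine div_le_of_le_mul₀ hw0 (by norm_num) ?_
  nlinarith [mul_le_mul_of_nonneg_left hp.2 hu, mul_le_mul_of_nonneg_left hq.2 hv]

theorem mul_merge {u v w p q : ℝ} (hu : 0 ≤ u) (hv : 0 ≤ v) (hw : u + v ≤ w) :
    w * ((u * p + v * q) / w) = u * p + v * q := by
  rcases eq_or_ne w 0 with rfl | hw0
  · have hu' : u = 0 := by linarith
    have hv' : v = 0 := by linarith
    simp [hu', hv']
  · field_simp

/-- A less programmed memory can imitate one write on a more programmed memory, with programming
probabilities that do not exceed `1 / 2`. -/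
theorem exists_imitation {x y x' y' a b : ℝ} (hx : 0 ≤ x) (hy : 0 ≤ y) (hy' : 0 ≤ y')
    (hxx : x ≤ x') (hs : x + y ≤ x' + y') (ha : a ∈ Set.Icc (0 : ℝ) 1)
    (hb : b ∈ Set.Icc (0 : ℝ) 1) :
    ∃ a' ∈ Set.Icc (0 : ℝ) (1 / 2), ∃ b' ∈ Set.Icc (0 : ℝ) (1 / 2),
      x * h a + y * h b ≤ x' * h a' + y' * h b' ∧ x * (1 - a) ≤ x' * (1 - a') ∧
      x * (1 - a) + (y * (1 - b) + x * a) ≤ x' * (1 - a') + (y' * (1 - b') + x' * a') := by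
  have key : ∀ {p : ℝ}, p ∈ Set.Icc (0 : ℝ) 1 → min p (1 - p) ∈ Set.Icc (0 : ℝ) (1 / 2) := by
    intro p hp
    refine ⟨le_min hp.1 (by linarith [hp.2]), ?_⟩
    rcases le_total p (1 / 2) with h1 | h1
    · exact (min_le_left _ _).trans h1
    · exact (min_le_right _ _).trans (by linarith)
  have hsub : Set.Icc (0 : ℝ) (1 / 2) ⊆ Set.Icc 0 1 := Set.Icc_subset_Icc_right (by norm_num)
  -- Here c is the part of the once-programmed mass y that is imitated on the surplus x' - x of
  -- fresh cells; the remaining y - c fits into y'. Replacing p by min p (1 - p) keeps the entropy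
  -- and programs no more cells.
  obtain ⟨c, hc⟩ : ∃ c, c = min (x' - x) y := ⟨_, rfl⟩
  have hc0 : 0 ≤ c := hc ▸ le_min (by linarith) hy
  have hc1 : c ≤ x' - x := hc ▸ min_le_left _ _
  have hc2 : c ≤ y := hc ▸ min_le_right _ _
  have hc3 : y - c ≤ y' := by
    rcases min_choice (x' - x) y with e | e <;> rw [e] at hc <;> linarith
  have m1 := mul_merge (p := min a (1 - a)) (q := min b (1 - b)) hx hc0
    (show x + c ≤ x' by linarith)
  have m2 := mul_merge (p := min b (1 - b)) (q := 0) (sub_nonneg.mpr hc2) le_rfl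
    (show y - c + 0 ≤ y' by linarith)
  have e1 := h_merge hx hc0 (show x + c ≤ x' by linarith) (hsub (key ha)) (hsub (key hb))
  have e2 := h_merge (sub_nonneg.mpr hc2) le_rfl (show y - c + 0 ≤ y' by linarith)
    (hsub (key hb)) (q := 0) (by norm_num)
  refine ⟨_, merge_mem hx hc0 (show x + c ≤ x' by linarith) (key ha) (key hb), _,
    merge_mem (sub_nonneg.mpr hc2) le_rfl (show y - c + 0 ≤ y' by linarith) (key hb)
      (q := 0) (by norm_num), ?_, ?_, ?_⟩
  · simp only [h_min] at e1 e2
    linarith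
  · rw [mul_sub x', m1]
    have := mul_le_mul_of_nonneg_left (min_le_left a (1 - a)) hx
    have := mul_le_mul_of_nonneg_left (hsub (key hb)).2 hc0
    linarith
  · rw [mul_sub x', mul_sub y', m2]
    have := mul_le_mul_of_nonneg_left (min_le_left b (1 - b)) hy
    have := mul_nonneg hc0 (key hb).1
    linarith

/-- Programming probabilities in `[0, 1]` can be replaced by probabilities in `[0, 1 / 2]`. -/
theorem exists_rate_ge {t : ℕ} {x y a b : ℕ → ℝ} (hx0 : x 0 = 1) (hy0 : y 0 = 0)
    (hx : ∀ j, 0 ≤ x j) (hy : ∀ j, 0 ≤ y j)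
    (ha : ∀ j, a j ∈ Set.Icc (0 : ℝ) 1) (hb : ∀ j, b j ∈ Set.Icc (0 : ℝ) 1)
    (hxs : ∀ j < t, x (j + 1) = x j * (1 - a j))
    (hys : ∀ j < t, y (j + 1) = y j * (1 - b j) + x j * a j) :
    ∃ a' b' : ℕ → ℝ, (∀ j, a' j ∈ Set.Icc (0 : ℝ) (1 / 2)) ∧
      (∀ j, b' j ∈ Set.Icc (0 : ℝ) (1 / 2)) ∧
      ∀ j < t, x j * h (a j) + y j * h (b j) ≤ rate a' b' j := by
  -- The imitation is made total in the dominating pair `z`, with default (0, 0) where domination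
  -- fails, so that probabilities can be chosen as functions of `z` before the recursion that
  -- defines it.
  have step : ∀ (j : ℕ) (z : ℝ × ℝ), ∃ c : ℝ × ℝ,
      c.1 ∈ Set.Icc (0 : ℝ) (1 / 2) ∧ c.2 ∈ Set.Icc (0 : ℝ) (1 / 2) ∧
      (0 ≤ z.2 → x j ≤ z.1 → x j + y j ≤ z.1 + z.2 →
        x j * h (a j) + y j * h (b j) ≤ z.1 * h c.1 + z.2 * h c.2 ∧
        x j * (1 - a j) ≤ z.1 * (1 - c.1) ∧
        x j * (1 - a j) + (y j * (1 - b j) + x j * a j) ≤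
          z.1 * (1 - c.1) + (z.2 * (1 - c.2) + z.1 * c.1)) := by
    intro j z
    by_cases hz : 0 ≤ z.2 ∧ x j ≤ z.1 ∧ x j + y j ≤ z.1 + z.2
    · obtain ⟨a', ha', b', hb', H⟩ :=
        exists_imitation (hx j) (hy j) hz.1 hz.2.1 hz.2.2 (ha j) (hb j)
      exact ⟨(a', b'), ha', hb', fun _ _ _ => H⟩
    · exact ⟨(0, 0), by norm_num, by norm_num, fun h1 h2 h3 => absurd ⟨h1, h2, h3⟩ hz⟩
  choose c hc1 hc2 hc using step
  let z : ℕ → ℝ × ℝ := fun j => Nat.rec (1, 0) (fun j z =>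
    (z.1 * (1 - (c j z).1), z.2 * (1 - (c j z).2) + z.1 * (c j z).1)) j
  have hz : ∀ j, fresh (fun j => (c j (z j)).1) (fun j => (c j (z j)).2) j = z j := by
    intro j
    induction j with
    | zero => rfl
    | succ j ih => rw [fresh, ih]
  have hdom : ∀ j ≤ t, 0 ≤ (z j).2 ∧ x j ≤ (z j).1 ∧ x j + y j ≤ (z j).1 + (z j).2 := by
    intro j
    induction j with
    | zero => intro _; simp [z, hx0, hy0]
    | succ j ih =>
      intro hj
      obtain ⟨h1, h2, h3⟩ := ih (by omega)
      obtain ⟨-, g2, g3⟩ := hc j (z j) h1 h2 h3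
      rw [hxs j (by omega), hys j (by omega)]
      refine ⟨?_, g2, g3⟩
      have e1 := hc1 j (z j)
      have e2 := hc2 j (z j)
      exact add_nonneg (mul_nonneg h1 (by linarith [e2.2]))
        (mul_nonneg ((hx j).trans h2) e1.1)
  refine ⟨fun j => (c j (z j)).1, fun j => (c j (z j)).2, fun j => hc1 _ _, fun j => hc2 _ _, ?_⟩
  intro j hj
  obtain ⟨h1, h2, h3⟩ := hdom j hj.le
  rw [rate, hz]
  exact (hc j (z j) h1 h2 h3).1

/-! ### Closedness of the rate region -/

theorem fresh_continuous (j : ℕ) :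
    Continuous fun p : (ℕ → ℝ) × (ℕ → ℝ) => fresh p.1 p.2 j := by
  induction j with
  | zero => exact continuous_const
  | succ j ih =>
    simp only [fresh]
    fun_prop

theorem rate_continuous (j : ℕ) : Continuous fun p : (ℕ → ℝ) × (ℕ → ℝ) => rate p.1 p.2 j := by
  have h1 := fresh_continuous j
  have h2 := h_continuous
  unfold rate
  fun_prop

/-- The region is closed: it suffices to approximate a rate tuple. -/
theorem mem_rateRegion_of_approx {t : ℕ} {R : Fin t → ℝ} (r : Fin t → ℕ → ℝ)
    (hr : ∀ j, Filter.Tendsto (r j) Filter.atTop (nhds (R j)))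
    (H : ∀ N, (fun j => r j N) ∈ rateRegion t) : R ∈ rateRegion t := by
  choose a b ha hb hR using H
  -- By Tychonoff the admissible probability sequences form a compact set, and each rate is
  -- continuous in them for the product topology.
  have hK : IsCompact ((Set.univ.pi fun _ : ℕ => Set.Icc (0 : ℝ) (1 / 2)) ×ˢ
      (Set.univ.pi fun _ : ℕ => Set.Icc (0 : ℝ) (1 / 2))) :=
    (isCompact_univ_pi fun _ => isCompact_Icc).prod (isCompact_univ_pi fun _ => isCompact_Icc)
  obtain ⟨p, hp, φ, hφ, hlim⟩ := hK.tendsto_subseq (x := fun N => (a N, b N))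
    (fun N => ⟨fun j _ => ha N j, fun j _ => hb N j⟩)
  refine ⟨p.1, p.2, fun j => hp.1 j trivial, fun j => hp.2 j trivial, fun j => ?_⟩
  exact le_of_tendsto_of_tendsto' ((hr j).comp hφ.tendsto_atTop)
    (((rate_continuous j).tendsto p).comp hlim) fun N => hR (φ N) j

/-! ### Fano's inequality and subadditivity for a fixed memory content -/

theorem sum_prod_pi {ι κ : Type*} [Fintype ι] [DecidableEq ι] [Fintype κ] (f : ι → κ → ℝ) :
    ∑ c : ι → κ, ∏ i, f i (c i) = ∏ i, ∑ x, f i x := by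
  rw [Finset.prod_univ_sum, Fintype.piFinset_univ]

/-- Each nonempty fibre of `f` contributes its value of `g` exactly once. -/
theorem sum_div_card_fiber {α β : Type*} [Fintype α] [DecidableEq β] (f : α → β) (g : β → ℝ) :
    ∑ a, g (f a) / (Finset.univ.filter fun a' => f a' = f a).card =
      ∑ y ∈ Finset.univ.image f, g y := by
  rw [← Finset.sum_fiberwise_of_maps_to (t := Finset.univ.image f) (g := f) (by simp)]
  refine Finset.sum_congr rfl fun y hy => ?_
  have e : ∀ a ∈ Finset.univ.filter (fun a => f a = y),
      g (f a) / ((Finset.univ.filter fun a' => f a' = f a).card : ℝ) =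
        g y / (Finset.univ.filter fun a' => f a' = y).card := by
    intro a ha
    rw [(Finset.mem_filter.mp ha).2]
  rw [Finset.sum_congr rfl e, Finset.sum_const, nsmul_eq_mul]
  obtain ⟨a, -, ha⟩ := Finset.mem_image.mp hy
  have : 0 < (Finset.univ.filter fun a' => f a' = y).card :=
    Finset.card_pos.mpr ⟨a, by simp [ha]⟩
  field_simp

/-- Fano's inequality for a uniformly distributed message: the logarithms of the ambiguity. -/
theorem sum_log_card_fiber_le {M : ℕ} {β : Type*} [DecidableEq β] (f : Fin M → β)
    (d : β → Fin M) :
    ∑ m, Real.log (Finset.univ.filter fun m' => f m' = f m).card ≤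
      (Finset.univ.filter fun m => d (f m) ≠ m).card * (Real.log M + 1) := by
  have hlogM : 0 ≤ Real.log M := Real.log_natCast_nonneg M
  have h1 : ∀ m, Real.log (Finset.univ.filter fun m' => f m' = f m).card ≤
      (Real.log M + 1) *
        (1 - 1 / ((Finset.univ.filter fun m' => f m' = f m).card : ℝ)) := by
    intro m
    have hpos : 0 < (Finset.univ.filter fun m' => f m' = f m).card :=
      Finset.card_pos.mpr ⟨m, by simp⟩
    have hle : (Finset.univ.filter fun m' => f m' = f m).card ≤ M := by
      simpa using Finset.card_filter_le (Finset.univ : Finset (Fin M)) fun m' => f m' = f m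
    generalize (Finset.univ.filter fun m' => f m' = f m).card = x at hpos hle
    have hx : (1 : ℝ) ≤ x := by exact_mod_cast hpos
    have e1 : Real.log x ≤ Real.log M :=
      Real.log_le_log (by linarith) (by exact_mod_cast hle)
    have e2 : Real.log x ≤ x - 1 := Real.log_le_sub_one_of_pos (by linarith)
    -- Write x log x = (x - 1) log x + log x and use log x ≤ log M in the first term and log x ≤ x -
    -- 1 in the second.
    have e3 : (x : ℝ) * Real.log x ≤ (Real.log M + 1) * (x - 1) := by nlinarith
    calc Real.log x = x * Real.log x / x := by field_simp
      _ ≤ (Real.log M + 1) * (x - 1) / x := div_le_div_of_nonneg_right e3 (by linarith)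
      _ = _ := by field_simp
  refine (Finset.sum_le_sum fun m _ => h1 m).trans ?_
  rw [← Finset.mul_sum, Finset.sum_sub_distrib, sum_div_card_fiber f (fun _ => 1), mul_comm]
  refine mul_le_mul_of_nonneg_right ?_ (by linarith)
  -- Correctly decoded messages have distinct words, so M minus the size of the image is at most the
  -- number of errors.
  have h2 : (Finset.univ.filter fun m => d (f m) = m).card ≤ (Finset.univ.image f).card := by
    refine Finset.card_le_card_of_injOn f (fun m _ => by simp) ?_
    intro m hm m' hm' e
    have hm := (Finset.mem_filter.mp hm).2
    have hm' := (Finset.mem_filter.mp hm').2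
    rw [← hm, e, hm']
  have h3 := Finset.card_filter_add_card_filter_not (s := (Finset.univ : Finset (Fin M)))
    (fun m => d (f m) = m)
  simp only [Finset.sum_const, nsmul_eq_mul, mul_one, Finset.card_univ, Fintype.card_fin] at h3 ⊢
  have h4 : (Finset.univ.filter fun m => d (f m) = m).card +
    ((Finset.univ.filter fun m => d (f m) ≠ m).card : ℝ) = M := by exact_mod_cast h3
  have h5 : ((Finset.univ.filter fun m => d (f m) = m).card : ℝ) ≤ (Finset.univ.image f).card := by
    exact_mod_cast h2
  linarith

/-- A word that differs from a reference word in each cell with small probability carries little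
information: Fano's inequality and subadditivity of the entropy for a fixed memory content. -/
theorem log_card_le {M n : ℕ} (f : Fin M → State n) (d : State n → Fin M) (s : State n)
    (r : Fin n → ℝ)
    (hr : ∀ k, r k = (Finset.univ.filter fun m => f m k ≠ s k).card / (M : ℝ)) :
    M * Real.log M ≤ M * ∑ k, Real.binEntropy (r k) +
      (Finset.univ.filter fun m => d (f m) ≠ m).card * (Real.log M + 1) := by
  have hM : (0 : ℝ) < M := by
    have : 0 < M := (d s).pos
    exact_mod_cast this
  have hcard : ∀ k, ((Finset.univ.filter fun m => f m k = s k).card : ℝ) =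
      M * (1 - r k) := by
    intro k
    have h3 := Finset.card_filter_add_card_filter_not (s := (Finset.univ : Finset (Fin M)))
      (fun m => f m k = s k)
    rw [Finset.card_univ, Fintype.card_fin] at h3
    have h4 : ((Finset.univ.filter fun m => f m k = s k).card : ℝ) +
      ((Finset.univ.filter fun m => f m k ≠ s k).card : ℝ) = M := by exact_mod_cast h3
    rw [hr]
    field_simp
    linarith
  have hcard' : ∀ k, ((Finset.univ.filter fun m => f m k ≠ s k).card : ℝ) = M * r k := by
    intro k
    rw [hr]
    field_simp
  -- The product of the marginal laws of the cells, as a comparison measure on words.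
  let u : Fin n → Fin 2 → ℝ := fun k x => if x = s k then 1 - r k else r k
  have hr0 : ∀ k, 0 ≤ r k := fun k => by rw [hr]; exact div_nonneg (Nat.cast_nonneg _) hM.le
  have hr1 : ∀ k, 0 ≤ 1 - r k := fun k => by
    have : 0 ≤ M * (1 - r k) := by rw [← hcard]; exact Nat.cast_nonneg _
    exact nonneg_of_mul_nonneg_right this hM
  have hu0 : ∀ k x, 0 ≤ u k x := by
    intro k x
    simp only [u]
    split_ifs
    · exact hr1 k
    · exact hr0 k
  have hu : ∀ m k, 0 < u k (f m k) := by
    intro m k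
    simp only [u]
    split_ifs with e
    · have : 0 < (Finset.univ.filter fun m => f m k = s k).card :=
        Finset.card_pos.mpr ⟨m, by simp [e]⟩
      have : 0 < M * (1 - r k) := by rw [← hcard]; exact_mod_cast this
      exact pos_of_mul_pos_right this hM.le
    · have : 0 < (Finset.univ.filter fun m => f m k ≠ s k).card :=
        Finset.card_pos.mpr ⟨m, by simp [e]⟩
      have : 0 < M * r k := by rw [← hcard']; exact_mod_cast this
      exact pos_of_mul_pos_right this hM.le
  have hsum : ∑ y : State n, ∏ k, u k (y k) = 1 := by
    rw [sum_prod_pi]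
    refine Finset.prod_eq_one fun k _ => ?_
    simp only [u, Fin.sum_univ_two]
    rcases (show s k = 0 ∨ s k = 1 by omega) with e | e <;> simp [e]
  -- Gibbs' inequality: a word has true probability (fibre size)/M and comparison weight ∏ u, and
  -- log z ≤ z - 1 bounds the sum of the logarithms of their ratios.
  have hB : ∑ m, Real.log ((∏ k, u k (f m k)) * M /
      (Finset.univ.filter fun m' => f m' = f m).card) ≤ 0 := by
    have h1 : ∀ m, Real.log ((∏ k, u k (f m k)) * M /
        (Finset.univ.filter fun m' => f m' = f m).card) ≤ (∏ k, u k (f m k)) * M /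
        (Finset.univ.filter fun m' => f m' = f m).card - 1 := by
      intro m
      refine Real.log_le_sub_one_of_pos ?_
      have hpos : 0 < (Finset.univ.filter fun m' => f m' = f m).card :=
        Finset.card_pos.mpr ⟨m, by simp⟩
      exact div_pos (mul_pos (Finset.prod_pos fun k _ => hu m k) hM) (by exact_mod_cast hpos)
    refine (Finset.sum_le_sum fun m _ => h1 m).trans ?_
    rw [Finset.sum_sub_distrib,
      sum_div_card_fiber f (fun y => (∏ k, u k (y k)) * M), ← Finset.sum_mul]
    have h2 : ∑ y ∈ Finset.univ.image f, ∏ k, u k (y k) ≤ 1 := by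
      rw [← hsum]
      exact Finset.sum_le_sum_of_subset_of_nonneg (Finset.subset_univ _)
        fun y _ _ => Finset.prod_nonneg fun k _ => hu0 _ _
    simp only [Finset.sum_const, Finset.card_univ, Fintype.card_fin, nsmul_eq_mul, mul_one]
    nlinarith
  have hC : ∑ m, Real.log (∏ k, u k (f m k)) = - (M * ∑ k, Real.binEntropy (r k)) := by
    have h1 : ∀ m, Real.log (∏ k, u k (f m k)) = ∑ k, Real.log (u k (f m k)) :=
      fun m => Real.log_prod fun k _ => (hu m k).ne'
    rw [Finset.sum_congr rfl fun m _ => h1 m, Finset.sum_comm, Finset.mul_sum,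
      ← Finset.sum_neg_distrib]
    refine Finset.sum_congr rfl fun k _ => ?_
    have h2 : ∀ m, Real.log (u k (f m k)) =
        if f m k = s k then Real.log (1 - r k) else Real.log (r k) := by
      intro m
      simp only [u]
      split_ifs <;> rfl
    rw [Finset.sum_congr rfl fun m _ => h2 m, Finset.sum_ite, Finset.sum_const, Finset.sum_const,
      nsmul_eq_mul, nsmul_eq_mul, hcard, hcard', Real.binEntropy, Real.log_inv, Real.log_inv]
    ring
  have hA := sum_log_card_fiber_le f d
  have hsplit : ∀ m, Real.log M = Real.log ((∏ k, u k (f m k)) * M /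
        (Finset.univ.filter fun m' => f m' = f m).card) - Real.log (∏ k, u k (f m k)) +
        Real.log (Finset.univ.filter fun m' => f m' = f m).card := by
    intro m
    have hpos : 0 < (Finset.univ.filter fun m' => f m' = f m).card :=
      Finset.card_pos.mpr ⟨m, by simp⟩
    have hpos' : ((Finset.univ.filter fun m' => f m' = f m).card : ℝ) ≠ 0 := by
      exact_mod_cast hpos.ne'
    have := (Finset.prod_pos fun k (_ : k ∈ Finset.univ) => hu m k).ne'
    rw [Real.log_div (mul_ne_zero this hM.ne') hpos', Real.log_mul this hM.ne']
    ring
  have htot : M * Real.log M = ∑ _m : Fin M, Real.log M := by simp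
  rw [htot, Finset.sum_congr rfl fun m _ => hsplit m, Finset.sum_add_distrib,
    Finset.sum_sub_distrib, hC]
  linarith

theorem h_jensen {ι : Type*} (s : Finset ι) (w r : ι → ℝ) (hw : ∀ i ∈ s, 0 ≤ w i)
    (hr : ∀ i ∈ s, r i ∈ Set.Icc (0 : ℝ) 1) :
    ∑ i ∈ s, w i * h (r i) ≤ (∑ i ∈ s, w i) * h ((∑ i ∈ s, w i * r i) / ∑ i ∈ s, w i) := by
  rcases eq_or_lt_of_le (Finset.sum_nonneg hw) with h0 | h0
  · rw [← h0, zero_mul]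
    refine (Finset.sum_eq_zero fun i hi => ?_).le
    rw [(Finset.sum_eq_zero_iff_of_nonneg hw).mp h0.symm i hi, zero_mul]
  · have := concaveOn_h.le_map_centerMass hw h0 hr
    simp only [Finset.centerMass, smul_eq_mul] at this
    rw [inv_mul_le_iff₀ h0] at this
    rwa [inv_mul_eq_div] at this

/-! ### The distribution of the count vector -/

section states

variable {X : Knowledge} {n t ℓ : ℕ} {M : Fin t → ℕ} (E : Encoders X n t ℓ M)

theorem stateProb_zero (v : Count n ℓ) : stateProb E 0 v = if v = 0 then 1 else 0 := rfl

theorem stateProb_succ (j : Fin t) (w : Count n ℓ) :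
    stateProb E j.succ w = ∑ m : Fin (M j), ∑ v : Count n ℓ,
      if newCount v (E j m (view X v)) = w then 1 / (M j : ℝ) * stateProb E j.castSucc v else 0 := by
  classical
  unfold stateProb
  rw [Fin.induction_succ]

theorem stateProb_nonneg (j : Fin (t + 1)) (v : Count n ℓ) : 0 ≤ stateProb E j v := by
  induction j using Fin.induction generalizing v with
  | zero => rw [stateProb_zero]; split_ifs <;> norm_num
  | succ j ih =>
    rw [stateProb_succ]
    refine Finset.sum_nonneg fun m _ => Finset.sum_nonneg fun v _ => ?_
    have := ih v
    split_ifs <;> positivity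

theorem countSet_succ (j : Fin t) {v : Count n ℓ} (hv : v ∈ countSet E j.castSucc)
    (m : Fin (M j)) : newCount v (E j m (view X v)) ∈ countSet E j.succ := by
  classical
  unfold countSet at hv ⊢
  rw [Fin.induction_succ]
  refine Finset.mem_image₂_of_mem hv ?_
  exact Finset.mem_image₂_of_mem (Finset.mem_univ m) hv

/-- The distribution lives on the reachable vectors, so sums over `countSet` may be extended to all
count vectors. -/
theorem stateProb_eq_zero (j : Fin (t + 1)) {v : Count n ℓ} (hv : v ∉ countSet E j) :
    stateProb E j v = 0 := by
  induction j using Fin.induction generalizing v with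
  | zero =>
    rw [stateProb_zero, if_neg]
    rintro rfl
    exact hv (Finset.mem_singleton_self _)
  | succ j ih =>
    rw [stateProb_succ]
    refine Finset.sum_eq_zero fun m _ => Finset.sum_eq_zero fun u _ => ?_
    split_ifs with e
    · rw [ih, mul_zero]
      intro hu
      exact hv (e ▸ countSet_succ E j hu m)
    · rfl

/-- The expectation after a write is computed by conditioning on the count vector before it. -/
theorem sum_stateProb_succ_mul (j : Fin t) (g : Count n ℓ → ℝ) :
    ∑ w, stateProb E j.succ w * g w =
      ∑ v, stateProb E j.castSucc v *
        (1 / (M j : ℝ) * ∑ m : Fin (M j), g (newCount v (E j m (view X v)))) := by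
  simp only [stateProb_succ, Finset.sum_mul, Finset.mul_sum]
  rw [Finset.sum_comm, Finset.sum_comm (s := (Finset.univ : Finset (Count n ℓ)))
    (t := (Finset.univ : Finset (Fin (M j))))]
  refine Finset.sum_congr rfl fun m _ => ?_
  rw [Finset.sum_comm]
  refine Finset.sum_congr rfl fun v _ => ?_
  simp only [ite_mul, zero_mul, Finset.sum_ite_eq, Finset.mem_univ, if_true]
  ring

theorem sum_stateProb (hM : ∀ j, 0 < M j) (j : Fin (t + 1)) : ∑ v, stateProb E j v = 1 := by
  induction j using Fin.induction with
  | zero => simp [stateProb_zero]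
  | succ j ih =>
    have h1 := sum_stateProb_succ_mul E j fun _ => 1
    have : (M j : ℝ) ≠ 0 := by exact_mod_cast (hM j).ne'
    simp only [mul_one, Finset.sum_const, Finset.card_univ, Fintype.card_fin, nsmul_eq_mul,
      one_div, inv_mul_cancel₀ this] at h1
    rw [h1, ih]

end states

theorem Code.card_pos {X Y : Knowledge} {n t ℓ : ℕ} {M : Fin t → ℕ} (C : Code X Y n t ℓ M)
    (j : Fin t) : 0 < M j :=
  (C.dec j (fun _ => 0) (view Y (fun _ => 0))).pos

theorem Code.errorProb_eq {X Y : Knowledge} {n t ℓ : ℕ} {M : Fin t → ℕ} (C : Code X Y n t ℓ M)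
    (j : Fin t) : C.errorProb j = ∑ v, stateProb C.enc j.castSucc v * (1 / (M j : ℝ) *
      (Finset.univ.filter fun m =>
        C.dec j (newState v (C.enc j m (view X v))) (view Y v) ≠ m).card) := by
  classical
  rw [errorProb, Finset.sum_comm]
  have h1 : ∀ v ∈ (Finset.univ : Finset (Count n ℓ)), v ∉ countSet C.enc j.castSucc →
      ∑ m : Fin (M j), 1 / (M j : ℝ) * stateProb C.enc j.castSucc v *
      (if C.dec j (newState v (C.enc j m (view X v))) (view Y v) = m then 0 else 1) = 0 := by
    intro v _ hv
    simp [stateProb_eq_zero _ _ hv]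
  rw [Finset.sum_subset (Finset.subset_univ _) h1]
  refine Finset.sum_congr rfl fun v _ => ?_
  rw [← Finset.mul_sum, Finset.card_filter, mul_comm (1 / (M j : ℝ)), mul_assoc]
  push_cast
  congr 2
  refine Finset.sum_congr rfl fun m _ => ?_
  split_ifs <;> first | rfl | contradiction

/-! ### The converse -/

section cells

variable {n : ℕ} (v : Count n 2) (c : State n) (k : Fin n)

theorem fin_three_cases (x : Fin 3) : x = 0 ∨ x = 1 ∨ x = 2 := by omega

/-- The change is measured by the stored state and not by the requested word `c`, so the balance
needs no admissibility and serves all encoders alike. -/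
theorem newCount_eq_zero_ite :
    (if newCount v c k = 0 then (1 : ℝ) else 0) = (if v k = 0 then 1 else 0) -
      if v k = 0 then (if newState v c k ≠ parity v k then 1 else 0) else 0 := by
  rcases fin_three_cases (v k) with e | e | e <;>
  rcases (show c k = 0 ∨ c k = 1 by omega) with e' | e' <;>
  simp [newCount, newState, parity, e, e', Fin.ext_iff]

theorem newCount_eq_one_ite :
    (if newCount v c k = 1 then (1 : ℝ) else 0) = (if v k = 1 then 1 else 0) -
      (if v k = 1 then (if newState v c k ≠ parity v k then 1 else 0) else 0) +
      if v k = 0 then (if newState v c k ≠ parity v k then 1 else 0) else 0 := by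
  rcases fin_three_cases (v k) with e | e | e <;>
  rcases (show c k = 0 ∨ c k = 1 by omega) with e' | e' <;>
  simp [newCount, newState, parity, e, e', Fin.ext_iff]

theorem newState_eq_parity {v : Count n 2} {k : Fin n} (hv : v k = 2) :
    newState v c k = parity v k := by
  simp [newState, hv]

end cells

section converse

variable {X Y : Knowledge} {n t : ℕ} {M : Fin t → ℕ} (E : Encoders X n t 2 M)

/-- The probability that write `j` changes cell `k` when the count vector is `v`. -/
noncomputable def flipProb (j : Fin t) (v : Count n 2) (k : Fin n) : ℝ :=
  (Finset.univ.filter fun m => newState v (E j m (view X v)) k ≠ parity v k).card / (M j : ℝ)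

/-- The mean number of cells that were programmed `i` times on the first `j` writes. -/
noncomputable def meanCells (i : Fin 3) (j : Fin (t + 1)) : ℝ :=
  ∑ p : Count n 2 × Fin n with p.1 p.2 = i, stateProb E j p.1

/-- The mean number of cells that were programmed `i` times before write `j` and change. -/
noncomputable def meanFlips (i : Fin 3) (j : Fin t) : ℝ :=
  ∑ p : Count n 2 × Fin n with p.1 p.2 = i, stateProb E j.castSucc p.1 * flipProb E j p.1 p.2

theorem flipProb_mem (j : Fin t) (v : Count n 2) (k : Fin n) :
    flipProb E j v k ∈ Set.Icc (0 : ℝ) 1 := by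
  refine ⟨div_nonneg (Nat.cast_nonneg _) (Nat.cast_nonneg _), div_le_one_of_le₀ ?_ (Nat.cast_nonneg _)⟩
  have := Finset.card_filter_le (Finset.univ : Finset (Fin (M j)))
    fun m => newState v (E j m (view X v)) k ≠ parity v k
  rw [Finset.card_univ, Fintype.card_fin] at this
  exact_mod_cast this

theorem meanCells_eq (i : Fin 3) (j : Fin (t + 1)) :
    meanCells E i j = ∑ v, stateProb E j v * ∑ k, if v k = i then (1 : ℝ) else 0 := by
  rw [meanCells, Finset.sum_filter, Fintype.sum_prod_type]
  simp only [Finset.mul_sum, mul_ite, mul_one, mul_zero]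

theorem meanFlips_eq (i : Fin 3) (j : Fin t) :
    meanFlips E i j = ∑ v, stateProb E j.castSucc v * (1 / (M j : ℝ) * ∑ m : Fin (M j), ∑ k,
      if v k = i then (if newState v (E j m (view X v)) k ≠ parity v k then (1 : ℝ) else 0)
      else 0) := by
  rw [meanFlips, Finset.sum_filter, Fintype.sum_prod_type]
  refine Finset.sum_congr rfl fun v _ => ?_
  rw [Finset.sum_comm, Finset.mul_sum, Finset.mul_sum]
  refine Finset.sum_congr rfl fun k _ => ?_
  by_cases hk : v k = i
  · simp only [hk, if_true, flipProb, Finset.card_filter]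
    push_cast
    ring
  · simp [hk]

theorem meanCells_zero (i : Fin 3) : meanCells E i 0 = if i = 0 then (n : ℝ) else 0 := by
  rw [meanCells_eq]
  simp only [stateProb_zero, ite_mul, one_mul, zero_mul, Finset.sum_ite_eq', Finset.mem_univ,
    if_true, Pi.zero_apply, eq_comm (a := (0 : Fin 3))]
  split_ifs <;> simp

theorem one_div_mul_sum_const {M : ℕ} (hM : 0 < M) (x : ℝ) :
    1 / (M : ℝ) * ∑ _m : Fin M, x = x := by
  have : (M : ℝ) ≠ 0 := by exact_mod_cast hM.ne'
  simp [this]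

theorem meanCells_zero_succ (hM : ∀ j, 0 < M j) (j : Fin t) :
    meanCells E 0 j.succ = meanCells E 0 j.castSucc - meanFlips E 0 j := by
  rw [meanCells_eq, sum_stateProb_succ_mul, meanCells_eq, meanFlips_eq E,
    ← Finset.sum_sub_distrib]
  refine Finset.sum_congr rfl fun v _ => ?_
  simp only [newCount_eq_zero_ite, Finset.sum_sub_distrib]
  rw [mul_sub, one_div_mul_sum_const (hM j), mul_sub]

theorem meanCells_one_succ (hM : ∀ j, 0 < M j) (j : Fin t) :
    meanCells E 1 j.succ = meanCells E 1 j.castSucc - meanFlips E 1 j + meanFlips E 0 j := by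
  rw [meanCells_eq, sum_stateProb_succ_mul, meanCells_eq, meanFlips_eq E, meanFlips_eq E,
    ← Finset.sum_sub_distrib, ← Finset.sum_add_distrib]
  refine Finset.sum_congr rfl fun v _ => ?_
  simp only [newCount_eq_one_ite, Finset.sum_add_distrib, Finset.sum_sub_distrib]
  rw [mul_add, mul_sub, one_div_mul_sum_const (hM j), mul_add, mul_sub]

theorem meanCells_nonneg (i : Fin 3) (j : Fin (t + 1)) : 0 ≤ meanCells E i j :=
  Finset.sum_nonneg fun _ _ => stateProb_nonneg _ _ _

theorem meanFlips_nonneg (i : Fin 3) (j : Fin t) : 0 ≤ meanFlips E i j :=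
  Finset.sum_nonneg fun _ _ => mul_nonneg (stateProb_nonneg _ _ _) (flipProb_mem _ _ _ _).1

theorem meanFlips_le (i : Fin 3) (j : Fin t) : meanFlips E i j ≤ meanCells E i j.castSucc :=
  Finset.sum_le_sum fun _ _ =>
    mul_le_of_le_one_right (stateProb_nonneg _ _ _) (flipProb_mem _ _ _ _).2

theorem meanFlips_div_mem (i : Fin 3) (j : Fin t) :
    meanFlips E i j / meanCells E i j.castSucc ∈ Set.Icc (0 : ℝ) 1 :=
  ⟨div_nonneg (meanFlips_nonneg _ _ _) (meanCells_nonneg _ _ _),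
    div_le_one_of_le₀ (meanFlips_le _ _ _) (meanCells_nonneg _ _ _)⟩

theorem meanCells_mul_div (i : Fin 3) (j : Fin t) :
    meanCells E i j.castSucc * (meanFlips E i j / meanCells E i j.castSucc) = meanFlips E i j := by
  rcases eq_or_ne (meanCells E i j.castSucc) 0 with e | e
  · have h1 := meanFlips_le E i j
    have h2 := meanFlips_nonneg E i j
    rw [e] at h1 ⊢
    linarith
  · field_simp

/-- `log_card_le` holds for each fixed count vector, so even a decoder that knows the counts is
covered. Averaging over count vectors and applying Jensen to the pairs (vector, cell) with equal
count gives the two entropies; frozen cells never change and contribute nothing. -/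
theorem Code.logb_card_le (C : Code X Y n t 2 M) (j : Fin t) :
    Real.logb 2 (M j) ≤ meanCells C.enc 0 j.castSucc *
        h (meanFlips C.enc 0 j / meanCells C.enc 0 j.castSucc) +
      meanCells C.enc 1 j.castSucc *
        h (meanFlips C.enc 1 j / meanCells C.enc 1 j.castSucc) +
      C.errorProb j * (Real.logb 2 (M j) + 1 / Real.log 2) := by
  have hM := C.card_pos
  have hMj : (0 : ℝ) < M j := by exact_mod_cast hM j
  have hl2 : 0 < Real.log 2 := Real.log_pos (by norm_num)
  have hfix : ∀ v, Real.logb 2 (M j) ≤ ∑ k, h (flipProb C.enc j v k) + (1 / (M j : ℝ) *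
      (Finset.univ.filter fun m =>
        C.dec j (newState v (C.enc j m (view X v))) (view Y v) ≠ m).card) *
      (Real.logb 2 (M j) + 1 / Real.log 2) := by
    intro v
    have h1 := log_card_le (fun m => newState v (C.enc j m (view X v)))
      (fun y => C.dec j y (view Y v)) (parity v) (flipProb C.enc j v) (fun k => rfl)
    simp only [h, ← Finset.sum_div, Real.logb]
    refine le_of_mul_le_mul_left ?_ (mul_pos hMj hl2)
    field_simp
    linarith
  have hsum : ∑ v, stateProb C.enc j.castSucc v * ∑ k, h (flipProb C.enc j v k) ≤
      meanCells C.enc 0 j.castSucc * h (meanFlips C.enc 0 j / meanCells C.enc 0 j.castSucc) +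
      meanCells C.enc 1 j.castSucc *
        h (meanFlips C.enc 1 j / meanCells C.enc 1 j.castSucc) := by
    have hJ : ∀ i : Fin 3, ∑ p : Count n 2 × Fin n with p.1 p.2 = i,
        stateProb C.enc j.castSucc p.1 * h (flipProb C.enc j p.1 p.2) ≤
        meanCells C.enc i j.castSucc *
          h (meanFlips C.enc i j / meanCells C.enc i j.castSucc) := fun i =>
      h_jensen _ (fun p : Count n 2 × Fin n => stateProb C.enc j.castSucc p.1)
        (fun p => flipProb C.enc j p.1 p.2) (fun _ _ => stateProb_nonneg _ _ _)
        (fun _ _ => flipProb_mem _ _ _ _)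
    refine le_trans (le_of_eq ?_) (add_le_add (hJ 0) (hJ 1))
    rw [Finset.sum_filter, Finset.sum_filter, ← Finset.sum_add_distrib, Fintype.sum_prod_type]
    refine Finset.sum_congr rfl fun v _ => ?_
    rw [Finset.mul_sum]
    refine Finset.sum_congr rfl fun k _ => ?_
    rcases fin_three_cases (v k) with e | e | e
    · simp [e]
    · simp [e]
    · have : flipProb C.enc j v k = 0 := by simp [flipProb, newState_eq_parity _ e]
      simp [e, this, h_zero]
  have htot : Real.logb 2 (M j) = ∑ v, stateProb C.enc j.castSucc v * Real.logb 2 (M j) := by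
    rw [← Finset.sum_mul, sum_stateProb _ hM, one_mul]
  have hle : Real.logb 2 (M j) ≤ ∑ v, stateProb C.enc j.castSucc v *
      (∑ k, h (flipProb C.enc j v k) + (1 / (M j : ℝ) *
      (Finset.univ.filter fun m =>
        C.dec j (newState v (C.enc j m (view X v))) (view Y v) ≠ m).card) *
      (Real.logb 2 (M j) + 1 / Real.log 2)) := by
    conv_lhs => rw [htot]
    exact Finset.sum_le_sum fun v _ =>
      mul_le_mul_of_nonneg_left (hfix v) (stateProb_nonneg _ _ _)
  refine hle.trans ?_
  simp only [mul_add (stateProb C.enc j.castSucc _), Finset.sum_add_distrib]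
  refine add_le_add hsum (le_of_eq ?_)
  rw [C.errorProb_eq, Finset.sum_mul]
  exact Finset.sum_congr rfl fun v _ => by ring

/-- The mean fractions of fresh and once-programmed cells follow the recursion of `fresh`, with the
mean changes per cell as probabilities in [0, 1]; `exists_rate_ge` then restores the bound 1/2. -/
theorem Code.mem_rateRegion (C : Code X Y n t 2 M) (hn : 0 < n) {ε : ℝ}
    (hC : ∀ j, C.errorProb j ≤ ε) :
    (fun j => Real.logb 2 (M j) / n * (1 - ε) - ε / Real.log 2) ∈ rateRegion t := by
  have hM := C.card_pos
  have hn' : (0 : ℝ) < n := by exact_mod_cast hn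
  have hn1 : (1 : ℝ) ≤ n := by exact_mod_cast hn
  have hl2 : 0 < Real.log 2 := Real.log_pos (by norm_num)
  let x (i : Fin 3) (j : ℕ) : ℝ :=
    if hj : j < t + 1 then meanCells C.enc i ⟨j, hj⟩ / n else 0
  let a (i : Fin 3) (j : ℕ) : ℝ :=
    if hj : j < t then meanFlips C.enc i ⟨j, hj⟩ / meanCells C.enc i (Fin.castSucc ⟨j, hj⟩) else 0
  have hx : ∀ i j, 0 ≤ x i j := by
    intro i j
    simp only [x]
    split_ifs
    · exact div_nonneg (meanCells_nonneg _ _ _) hn'.le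
    · exact le_rfl
  have ha : ∀ i j, a i j ∈ Set.Icc (0 : ℝ) 1 := by
    intro i j
    simp only [a]
    split_ifs
    · exact meanFlips_div_mem _ _ _
    · norm_num
  have hxj : ∀ i (j : Fin t), x i j = meanCells C.enc i j.castSucc / n := by
    intro i j
    simp only [x]
    rw [dif_pos (by omega)]
    rfl
  have hxs : ∀ i (j : Fin t), x i (j + 1) = meanCells C.enc i j.succ / n := by
    intro i j
    simp only [x]
    rw [dif_pos (by omega)]
    rfl
  have haj : ∀ i (j : Fin t), a i j = meanFlips C.enc i j / meanCells C.enc i j.castSucc := by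
    intro i j
    simp only [a]
    rw [dif_pos j.isLt]
  have hmul : ∀ i (j : Fin t), x i j * a i j = meanFlips C.enc i j / n := by
    intro i j
    rw [hxj, haj, div_mul_eq_mul_div, meanCells_mul_div]
  obtain ⟨a', b', ha', hb', hR⟩ := exists_rate_ge (t := t) (x := x 0) (y := x 1) (a := a 0)
    (b := a 1)
    (by
      simp only [x]
      rw [dif_pos (by omega), show (⟨0, by omega⟩ : Fin (t + 1)) = 0 from rfl, meanCells_zero]
      simp [hn'.ne'])
    (by
      simp only [x]
      rw [dif_pos (by omega), show (⟨0, by omega⟩ : Fin (t + 1)) = 0 from rfl, meanCells_zero]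
      simp)
    (hx 0) (hx 1) (ha 0) (ha 1)
    (by
      intro j hj
      have e1 := hmul 0 ⟨j, hj⟩
      have e2 := hxj 0 ⟨j, hj⟩
      have e3 := hxs 0 ⟨j, hj⟩
      simp only at e1 e2 e3
      rw [mul_sub, e1, e2, e3, meanCells_zero_succ _ hM]
      ring)
    (by
      intro j hj
      have e1 := hmul 0 ⟨j, hj⟩
      have e2 := hmul 1 ⟨j, hj⟩
      have e3 := hxj 1 ⟨j, hj⟩
      have e4 := hxs 1 ⟨j, hj⟩
      simp only at e1 e2 e3 e4
      rw [mul_sub, e1, e2, e3, e4, meanCells_one_succ _ hM]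
      ring)
  refine ⟨a', b', ha', hb', fun j => le_trans ?_ (hR j j.isLt)⟩
  have h1 := C.logb_card_le j
  rw [← haj, ← haj] at h1
  rw [hxj, hxj]
  have hL : 0 ≤ Real.logb 2 (M j) :=
    Real.logb_nonneg (by norm_num) (by exact_mod_cast (hM j))
  have h2 : C.errorProb j * (Real.logb 2 (M j) + 1 / Real.log 2) ≤
      ε * (Real.logb 2 (M j) + 1 / Real.log 2) :=
    mul_le_mul_of_nonneg_right (hC j) (by positivity)
  have hε0 : 0 ≤ ε := by
    refine le_trans ?_ (hC j)
    rw [C.errorProb_eq]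
    exact Finset.sum_nonneg fun v _ => mul_nonneg (stateProb_nonneg _ _ _) (by positivity)
  have h3 : Real.logb 2 (M j) * (1 - ε) - ε / Real.log 2 ≤
      meanCells C.enc 0 j.castSucc * h (a 0 j) + meanCells C.enc 1 j.castSucc * h (a 1 j) := by
    rw [div_eq_mul_one_div ε]
    linarith
  have h4 : ε / Real.log 2 / n ≤ ε / Real.log 2 := div_le_self (by positivity) hn1
  calc Real.logb 2 (M j) / n * (1 - ε) - ε / Real.log 2
      ≤ (Real.logb 2 (M j) * (1 - ε) - ε / Real.log 2) / n := by
        rw [sub_div]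
        have : Real.logb 2 (M j) / n * (1 - ε) = Real.logb 2 (M j) * (1 - ε) / n := by ring
        linarith
    _ ≤ _ := div_le_div_of_nonneg_right h3 hn'.le
    _ = _ := by ring

theorem rateRegion_mono {t : ℕ} {R R' : Fin t → ℝ} (hR : R ∈ rateRegion t)
    (hle : ∀ j, R' j ≤ R j) : R' ∈ rateRegion t := by
  obtain ⟨a, b, ha, hb, H⟩ := hR
  exact ⟨a, b, ha, hb, fun j => (hle j).trans (H j)⟩

theorem epsCapacity_subset (X Y : Knowledge) (t : ℕ) : epsCapacity X Y t 2 ⊆ rateRegion t := by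
  intro R hR
  -- Codes of tolerance 1/(N + 1) give rate tuples of the region that tend to R.
  let e : ℕ → ℝ := fun N => 1 / ((N : ℝ) + 1)
  have he : Filter.Tendsto e Filter.atTop (nhds 0) := tendsto_one_div_add_atTop_nhds_zero_nat
  refine mem_rateRegion_of_approx
    (fun j N => (R j - e N) * (1 - e N) - e N / Real.log 2) (fun j => ?_) fun N => ?_
  · have := ((tendsto_const_nhds (x := R j)).sub he).mul ((tendsto_const_nhds (x := (1 : ℝ))).sub he)
    simpa using this.sub (he.div_const (Real.log 2))
  · have h0 : 0 < e N := by positivity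
    have h1 : e N ≤ 1 := by
      refine div_le_one_of_le₀ ?_ (by positivity)
      have : (0 : ℝ) ≤ N := Nat.cast_nonneg N
      linarith
    obtain ⟨n, M, C, hn, hC⟩ := hR (e N) h0
    refine rateRegion_mono (C.mem_rateRegion hn fun j => (hC j).1) fun j => ?_
    have := mul_le_mul_of_nonneg_right (hC j).2 (sub_nonneg.mpr h1)
    linarith

end converse

/-! ### Product measures on words and concentration -/

section product

variable {ι κ : Type*} [Fintype ι] [DecidableEq ι] [Fintype κ] {f : ι → κ → ℝ}

theorem sum_prod_pi_mul (hf : ∀ i, ∑ x, f i x = 1) (i : ι) (u : κ → ℝ) :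
    ∑ c : ι → κ, (∏ k, f k (c k)) * u (c i) = ∑ x, f i x * u x := by
  have h1 : ∀ c : ι → κ, (∏ k, f k (c k)) * u (c i) =
      ∏ k, f k (c k) * if k = i then u (c k) else 1 := by
    intro c
    rw [Finset.prod_mul_distrib, Finset.prod_ite_eq' Finset.univ i fun k => u (c k)]
    simp
  simp only [h1]
  rw [sum_prod_pi fun k x => f k x * if k = i then u x else 1,
    Finset.prod_eq_single i (fun k _ hk => by simp [hk, hf]) (by simp)]
  simp

theorem sum_prod_pi_mul_mul (hf : ∀ i, ∑ x, f i x = 1) {i j : ι} (hij : i ≠ j) (u v : κ → ℝ) :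
    ∑ c : ι → κ, (∏ k, f k (c k)) * (u (c i) * v (c j)) =
      (∑ x, f i x * u x) * ∑ x, f j x * v x := by
  have h1 : ∀ c : ι → κ, (∏ k, f k (c k)) * (u (c i) * v (c j)) =
      ∏ k, f k (c k) * ((if k = i then u (c k) else 1) * if k = j then v (c k) else 1) := by
    intro c
    rw [Finset.prod_mul_distrib, Finset.prod_mul_distrib,
      Finset.prod_ite_eq' Finset.univ i fun k => u (c k),
      Finset.prod_ite_eq' Finset.univ j fun k => v (c k)]
    simp
  simp only [h1]
  rw [sum_prod_pi fun k x => f k x * ((if k = i then u x else 1) * if k = j then v x else 1),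
    Finset.prod_eq_mul i j hij (fun k _ hk => by simp [hk.1, hk.2, hf]) (by simp) (by simp)]
  simp [hij, hij.symm]

end product

/-- The weight of a word that differs from `s` in cell `k` with probability `r k`. -/
noncomputable def wordWeight {n : ℕ} (r : Fin n → ℝ) (s c : State n) : ℝ :=
  ∏ k, if c k = s k then 1 - r k else r k

section wordWeight

variable {n : ℕ} {r : Fin n → ℝ} (s : State n)

theorem sum_flip (p : ℝ) (x : Fin 2) : ∑ y : Fin 2, (if y = x then 1 - p else p) = 1 := by
  rw [Fin.sum_univ_two]
  rcases (show x = 0 ∨ x = 1 by omega) with e | e <;> simp [e]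

theorem sum_flip_mul (p : ℝ) (x : Fin 2) (u w : ℝ) :
    ∑ y : Fin 2, (if y = x then 1 - p else p) * (if y = x then u else w) =
      (1 - p) * u + p * w := by
  rw [Fin.sum_univ_two]
  rcases (show x = 0 ∨ x = 1 by omega) with e | e <;> simp [e, add_comm]

theorem sum_wordWeight : ∑ c, wordWeight r s c = 1 := by
  unfold wordWeight
  rw [sum_prod_pi fun k x => if x = s k then 1 - r k else r k]
  exact Finset.prod_eq_one fun k _ => sum_flip _ _

theorem wordWeight_nonneg (hr : ∀ k, r k ∈ Set.Icc (0 : ℝ) 1) (c : State n) :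
    0 ≤ wordWeight r s c := by
  refine Finset.prod_nonneg fun k _ => ?_
  have := hr k
  split_ifs
  · linarith [this.2]
  · exact this.1

/-- The variance of a binomial count: the centred cell indicators are independent, so the
off-diagonal terms of the squared sum vanish. -/
theorem sum_wordWeight_mul_sq (T : Finset (Fin n)) {p : ℝ} (hT : ∀ k ∈ T, r k = p) :
    ∑ c, wordWeight r s c * (((T.filter fun k => c k ≠ s k).card : ℝ) - T.card * p) ^ 2 =
      T.card * (p * (1 - p)) := by
  let g : Fin n → Fin 2 → ℝ := fun k x => if x = s k then -p else 1 - p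
  have h1 : ∀ c : State n, (((T.filter fun k => c k ≠ s k).card : ℝ) - T.card * p) ^ 2 =
      ∑ k ∈ T, ∑ l ∈ T, g k (c k) * g l (c l) := by
    intro c
    have : ((T.filter fun k => c k ≠ s k).card : ℝ) - T.card * p = ∑ k ∈ T, g k (c k) := by
      rw [Finset.card_filter]
      push_cast
      rw [← nsmul_eq_mul, ← Finset.sum_const, ← Finset.sum_sub_distrib]
      refine Finset.sum_congr rfl fun k _ => ?_
      simp only [g, ne_eq, ite_not]
      split_ifs <;> ring
    rw [this, sq, Finset.sum_mul_sum]
  simp only [h1, Finset.mul_sum]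
  rw [Finset.sum_comm, ← nsmul_eq_mul, ← Finset.sum_const]
  refine Finset.sum_congr rfl fun k hk => ?_
  rw [Finset.sum_comm, Finset.sum_eq_single_of_mem k hk]
  · have := sum_prod_pi_mul (f := fun k x => if x = s k then 1 - r k else r k)
      (fun k => sum_flip _ _) k fun x => g k x * g k x
    refine this.trans ?_
    have e : ∀ x, g k x * g k x = if x = s k then (-p) * (-p) else (1 - p) * (1 - p) := by
      intro x
      simp only [g]
      split_ifs <;> rfl
    simp only [e, sum_flip_mul, hT k hk]
    ring
  · intro l hl hlk
    have := sum_prod_pi_mul_mul (f := fun k x => if x = s k then 1 - r k else r k)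
      (fun k => sum_flip _ _) hlk.symm (g k) (g l)
    refine this.trans ?_
    simp only [g, sum_flip_mul, hT k hk]
    ring

/-- Chebyshev's inequality, with p(1 - p) ≤ 1/4 and at most n cells. -/
theorem sum_wordWeight_deviation_le (hr : ∀ k, r k ∈ Set.Icc (0 : ℝ) 1) (T : Finset (Fin n))
    {p δ : ℝ} (hT : ∀ k ∈ T, r k = p) (hp : p ∈ Set.Icc (0 : ℝ) 1) (hδ : 0 < δ) (hn : 0 < n) :
    ∑ c with ¬ |((T.filter fun k => c k ≠ s k).card : ℝ) - T.card * p| ≤ δ * n,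
      wordWeight r s c ≤ 1 / (4 * δ ^ 2 * n) := by
  have hn' : (0 : ℝ) < n := by exact_mod_cast hn
  have hTn : (T.card : ℝ) ≤ n := by
    have := Finset.card_le_univ T
    rw [Fintype.card_fin] at this
    exact_mod_cast this
  have h1 : (∑ c with ¬ |((T.filter fun k => c k ≠ s k).card : ℝ) - T.card * p| ≤ δ * n,
      wordWeight r s c) * (δ * n) ^ 2 ≤ T.card * (p * (1 - p)) := by
    rw [← sum_wordWeight_mul_sq s T hT, Finset.sum_mul]
    refine (Finset.sum_le_sum fun c hc => ?_).trans
      (Finset.sum_le_sum_of_subset_of_nonneg (Finset.filter_subset _ _) fun c _ _ =>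
        mul_nonneg (wordWeight_nonneg s hr c) (sq_nonneg _))
    refine mul_le_mul_of_nonneg_left ?_ (wordWeight_nonneg s hr c)
    rw [Finset.mem_filter, not_le] at hc
    rw [← sq_abs (_ - _)]
    exact pow_le_pow_left₀ (by positivity) hc.2.le 2
  have h2 : T.card * (p * (1 - p)) ≤ n * (1 / 4) :=
    mul_le_mul hTn (by nlinarith [sq_nonneg (p - 1 / 2)])
      (mul_nonneg hp.1 (by linarith [hp.2])) hn'.le
  rw [le_div_iff₀ (by positivity)]
  have h3 := h1.trans h2
  refine le_of_mul_le_mul_right ?_ hn'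
  linarith

/-- The cost of a deviation from the programming probability `p` in the exponent. -/
noncomputable def slope (p : ℝ) : ℝ := -Real.log p - Real.log (1 - p)

/-- The logarithm of the weight is affine in the number of changed cells, with slope log p - log (1
- p), whose absolute value is at most `slope p`. -/
theorem prod_flip_le (c : State n) (T : Finset (Fin n)) {p δ : ℝ} (hT : ∀ k ∈ T, r k = p)
    (hp : p ∈ Set.Icc (0 : ℝ) (1 / 2))
    (hc : |((T.filter fun k => c k ≠ s k).card : ℝ) - T.card * p| ≤ δ) :
    ∏ k ∈ T, (if c k = s k then 1 - r k else r k) ≤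
      Real.exp (-(T.card * Real.binEntropy p) + δ * slope p) := by
  have hp1 : p ∈ Set.Icc (0 : ℝ) 1 := ⟨hp.1, by linarith [hp.2]⟩
  -- At p = 0 the convention log 0 = 0 makes the right side 1, and the product is at most 1.
  rcases eq_or_lt_of_le hp.1 with rfl | h0
  · simp only [slope, Real.binEntropy_zero, mul_zero, neg_zero, Real.log_zero, sub_zero,
      Real.log_one, add_zero, Real.exp_zero]
    refine Finset.prod_le_one (fun k hk => ?_) fun k hk => ?_ <;> rw [hT k hk] <;> split_ifs <;>
      norm_num
  · have h1 : 0 < 1 - p := by linarith [hp.2]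
    have hpos : ∀ k ∈ T, 0 < if c k = s k then 1 - r k else r k := by
      intro k hk
      rw [hT k hk]
      split_ifs <;> assumption
    rw [← Real.log_le_iff_le_exp (Finset.prod_pos hpos),
      Real.log_prod fun k hk => (hpos k hk).ne']
    have h2 : ∑ k ∈ T, Real.log (if c k = s k then 1 - r k else r k) =
        ((T.filter fun k => c k ≠ s k).card : ℝ) * Real.log p +
          (T.card - (T.filter fun k => c k ≠ s k).card) * Real.log (1 - p) := by
      have h3 : ∀ k ∈ T, Real.log (if c k = s k then 1 - r k else r k) =
          if c k = s k then Real.log (1 - p) else Real.log p := by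
        intro k hk
        rw [hT k hk]
        split_ifs <;> rfl
      have h4 : ((T.filter fun k => c k = s k).card : ℝ) +
          (T.filter fun k => c k ≠ s k).card = T.card := by
        exact_mod_cast Finset.card_filter_add_card_filter_not (s := T) fun k => c k = s k
      rw [Finset.sum_congr rfl h3, Finset.sum_ite, Finset.sum_const, Finset.sum_const,
        nsmul_eq_mul, nsmul_eq_mul, ← h4]
      ring
    rw [h2, Real.binEntropy, Real.log_inv, Real.log_inv]
    generalize ((T.filter fun k => c k ≠ s k).card : ℝ) = K at hc ⊢
    have hl1 := Real.log_nonpos hp.1 hp1.2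
    have hl2 := Real.log_nonpos h1.le (by linarith)
    have h5 : (K - T.card * p) * (Real.log p - Real.log (1 - p)) ≤ δ * slope p := by
      refine (le_abs_self _).trans ?_
      rw [abs_mul]
      refine mul_le_mul hc ?_ (abs_nonneg _) ((abs_nonneg _).trans hc)
      rw [slope, abs_le]
      constructor <;> linarith
    linarith

end wordWeight

/-! ### Typical count vectors and balanced words -/

section typical

variable {n : ℕ}

/-- The cells that were programmed `i` times. -/
def cells (v : Count n 2) (i : Fin 3) : Finset (Fin n) := Finset.univ.filter fun k => v k = i

/-- The cells that were programmed `i` times and are to be changed when `c` is written. -/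
def flips (v : Count n 2) (c : State n) (i : Fin 3) : Finset (Fin n) :=
  (cells v i).filter fun k => c k ≠ parity v k

/-- Up to `δ * n`, the numbers of cells that were programmed never and exactly once are
`n * x.1` and `n * x.2`. -/
def Typical (x : ℝ × ℝ) (δ : ℝ) (v : Count n 2) : Prop :=
  |((cells v 0).card : ℝ) - n * x.1| ≤ δ * n ∧ |((cells v 1).card : ℝ) - n * x.2| ≤ δ * n

/-- Up to `δ * n`, writing `c` on `v` changes the fraction `a` of the cells that were never
programmed, and the fraction `b` of those that were programmed once. -/
def Balanced (a b δ : ℝ) (v : Count n 2) (c : State n) : Prop :=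
  |((flips v c 0).card : ℝ) - (cells v 0).card * a| ≤ δ * n ∧
    |((flips v c 1).card : ℝ) - (cells v 1).card * b| ≤ δ * n

theorem card_cells_cast (v : Count n 2) (i : Fin 3) :
    ((cells v i).card : ℝ) = ∑ k, if v k = i then (1 : ℝ) else 0 := by
  simp [cells]

theorem card_flips_cast (v : Count n 2) (c : State n) {i : Fin 3} (hi : i ≠ 2) :
    ((flips v c i).card : ℝ) =
      ∑ k, if v k = i then (if newState v c k ≠ parity v k then (1 : ℝ) else 0) else 0 := by
  rw [flips, cells, Finset.filter_filter, Finset.card_filter]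
  push_cast
  refine Finset.sum_congr rfl fun k _ => ?_
  have : v k = i → newState v c k = c k := by
    intro e
    have : (i : ℕ) < 2 := by omega
    simp [newState, e, this]
  by_cases e : v k = i
  · simp [e, this e]
  · simp [e]

theorem card_cells_newCount_zero (v : Count n 2) (c : State n) :
    ((cells (newCount v c) 0).card : ℝ) = (cells v 0).card - (flips v c 0).card := by
  rw [card_cells_cast, card_cells_cast, card_flips_cast v c (by decide),
    ← Finset.sum_sub_distrib]
  exact Finset.sum_congr rfl fun k _ => newCount_eq_zero_ite v c k

theorem card_cells_newCount_one (v : Count n 2) (c : State n) :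
    ((cells (newCount v c) 1).card : ℝ) =
      (cells v 1).card - (flips v c 1).card + (flips v c 0).card := by
  rw [card_cells_cast, card_cells_cast, card_flips_cast v c (by decide),
    card_flips_cast v c (by decide), ← Finset.sum_sub_distrib, ← Finset.sum_add_distrib]
  exact Finset.sum_congr rfl fun k _ => newCount_eq_one_ite v c k

theorem typical_zero {δ : ℝ} (hδ : 0 ≤ δ) : Typical (1, 0) δ (0 : Count n 2) := by
  have : 0 ≤ δ * n := by positivity
  constructor <;> simpa [cells] using this

/-- The factor 4 comes from the once-programmed cells: the deviations of both old cell counts and of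
both numbers of changes may add up. -/
theorem Typical.newCount {x : ℝ × ℝ} {a b δ : ℝ} {v : Count n 2} {c : State n}
    (hv : Typical x δ v) (hc : Balanced a b δ v c) (ha : a ∈ Set.Icc (0 : ℝ) 1)
    (hb : b ∈ Set.Icc (0 : ℝ) 1) :
    Typical (x.1 * (1 - a), x.2 * (1 - b) + x.1 * a) (4 * δ) (newCount v c) := by
  obtain ⟨hv0, hv1⟩ := hv
  obtain ⟨hc0, hc1⟩ := hc
  have hd := (abs_nonneg _).trans hv0
  have key : ∀ {z q : ℝ}, q ∈ Set.Icc (0 : ℝ) 1 → |z| ≤ δ * n → |z * q| ≤ δ * n := by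
    intro z q hq hz
    rw [abs_mul, abs_of_nonneg hq.1]
    exact (mul_le_of_le_one_right (abs_nonneg _) hq.2).trans hz
  have ha' : 1 - a ∈ Set.Icc (0 : ℝ) 1 := ⟨by linarith [ha.2], by linarith [ha.1]⟩
  have hb' : 1 - b ∈ Set.Icc (0 : ℝ) 1 := ⟨by linarith [hb.2], by linarith [hb.1]⟩
  have k1 := abs_le.mp (key ha' hv0)
  have k2 := abs_le.mp (key ha hv0)
  have k3 := abs_le.mp (key hb' hv1)
  rw [abs_le] at hc0 hc1
  constructor
  · rw [card_cells_newCount_zero, abs_le]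
    constructor <;> linarith
  · rw [card_cells_newCount_one, abs_le]
    constructor <;> linarith

theorem sum_wordWeight_not_balanced_le {r : Fin n → ℝ} (v : Count n 2)
    (hr : ∀ k, r k ∈ Set.Icc (0 : ℝ) 1) {a b δ : ℝ} (h0 : ∀ k ∈ cells v 0, r k = a)
    (h1 : ∀ k ∈ cells v 1, r k = b) (ha : a ∈ Set.Icc (0 : ℝ) 1) (hb : b ∈ Set.Icc (0 : ℝ) 1)
    (hδ : 0 < δ) (hn : 0 < n) [DecidablePred (Balanced a b δ v)] :
    ∑ c with ¬ Balanced a b δ v c, wordWeight r (parity v) c ≤ 1 / (2 * δ ^ 2 * n) := by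
  classical
  have e0 := sum_wordWeight_deviation_le (parity v) hr (cells v 0) h0 ha hδ hn
  have e1 := sum_wordWeight_deviation_le (parity v) hr (cells v 1) h1 hb hδ hn
  have hsub : (Finset.univ.filter fun c => ¬ Balanced a b δ v c) ⊆
      (Finset.univ.filter fun c => ¬ |((flips v c 0).card : ℝ) - (cells v 0).card * a| ≤ δ * n) ∪
      Finset.univ.filter fun c => ¬ |((flips v c 1).card : ℝ) - (cells v 1).card * b| ≤ δ * n := by
    intro c hc
    simp only [Finset.mem_filter, Finset.mem_union, Finset.mem_univ, true_and]
    exact not_and_or.mp (Finset.mem_filter.mp hc).2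
  have hnn : ∀ c, 0 ≤ wordWeight r (parity v) c := wordWeight_nonneg _ hr
  refine (Finset.sum_le_sum_of_subset_of_nonneg hsub fun c _ _ => hnn c).trans ?_
  have h3 := Finset.sum_union_inter (s₁ := (Finset.univ.filter fun c =>
      ¬ |((flips v c 0).card : ℝ) - (cells v 0).card * a| ≤ δ * n))
    (s₂ := Finset.univ.filter fun c =>
      ¬ |((flips v c 1).card : ℝ) - (cells v 1).card * b| ≤ δ * n)
    (f := wordWeight r (parity v))
  have h4 := Finset.sum_nonneg fun c (_ : c ∈ (Finset.univ.filter fun c =>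
      ¬ |((flips v c 0).card : ℝ) - (cells v 0).card * a| ≤ δ * n) ∩
    Finset.univ.filter fun c =>
      ¬ |((flips v c 1).card : ℝ) - (cells v 1).card * b| ≤ δ * n) => hnn c
  have h5 : 1 / (2 * δ ^ 2 * n) = 1 / (4 * δ ^ 2 * n) + 1 / (4 * δ ^ 2 * n) := by
    have : (n : ℝ) ≠ 0 := by exact_mod_cast hn.ne'
    field_simp
    norm_num
  rw [h5]
  unfold flips at *
  linarith

/-- The bound on the exponent of the probability of a balanced word. -/
theorem Balanced.prod_flip_le {r : Fin n → ℝ} {v : Count n 2} {c : State n} {x : ℝ × ℝ}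
    {a b δ : ℝ} (hc : Balanced a b δ v c) (hv : Typical x δ v)
    (h0 : ∀ k ∈ cells v 0, r k = a) (h1 : ∀ k ∈ cells v 1, r k = b)
    (hr : ∀ k, r k ∈ Set.Icc (0 : ℝ) 1)
    (ha : a ∈ Set.Icc (0 : ℝ) (1 / 2)) (hb : b ∈ Set.Icc (0 : ℝ) (1 / 2)) :
    ∏ k with v k ≠ 2, (if c k = parity v k then 1 - r k else r k) ≤
      Real.exp (-(n * (x.1 * Real.binEntropy a + x.2 * Real.binEntropy b)) +
        n * (δ * (slope a + slope b + 2))) := by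
  have hset : (Finset.univ.filter fun k => v k ≠ 2) = cells v 0 ∪ cells v 1 := by
    ext k
    simp only [cells, Finset.mem_filter, Finset.mem_union, Finset.mem_univ, true_and]
    rcases fin_three_cases (v k) with e | e | e <;> simp [e]
  have hdisj : Disjoint (cells v 0) (cells v 1) := by
    rw [Finset.disjoint_left]
    intro k hk hk'
    have e0 := (Finset.mem_filter.mp hk).2
    have e1 := (Finset.mem_filter.mp hk').2
    exact absurd (e0.symm.trans e1) (by decide)
  have hle : ∀ p, Real.binEntropy p ≤ 1 := fun p =>
    Real.binEntropy_le_log_two.trans (by linarith [Real.log_two_lt_d9])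
  have hd := (abs_nonneg _).trans hv.1
  have hn0 : ∀ {p}, p ∈ Set.Icc (0 : ℝ) (1 / 2) → 0 ≤ Real.binEntropy p := fun hp =>
    Real.binEntropy_nonneg hp.1 (by linarith [hp.2])
  have b0 := mul_le_mul_of_nonneg_right (abs_le.mp hv.1).1 (hn0 ha)
  have b1 := mul_le_mul_of_nonneg_right (abs_le.mp hv.2).1 (hn0 hb)
  have b2 := mul_le_mul_of_nonneg_left (hle a) hd
  have b3 := mul_le_mul_of_nonneg_left (hle b) hd
  rw [hset, Finset.prod_union hdisj]
  refine (mul_le_mul (ELM.prod_flip_le (parity v) c (cells v 0) h0 ha hc.1)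
    (ELM.prod_flip_le (parity v) c (cells v 1) h1 hb hc.2)
    (Finset.prod_nonneg fun k _ => ?_) (Real.exp_pos _).le).trans ?_
  · have := hr k
    split_ifs
    · linarith [this.2]
    · exact this.1
  · rw [← Real.exp_add, Real.exp_le_exp]
    linarith

end typical

/-! ### Zero-error codes for a fully informed encoder -/

/-- A random colouring shows every colour on every member of a family of large sets. -/
theorem exists_coloring {U V : Type*} [Fintype U] [DecidableEq U] [Fintype V] (A : V → Finset U)
    (S : V → Prop) {M : ℕ} (hM : 0 < M) {β : ℝ} (hβ : 0 ≤ β)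
    (hA : ∀ v, S v → (1 - 1 / (M : ℝ)) ^ (A v).card ≤ β)
    (hlt : Fintype.card V * (M * β) < 1) :
    ∃ f : U → Fin M, ∀ v, S v → ∀ m, ∃ u ∈ A v, f u = m := by
  classical
  have hM' : (M : ℝ) ≠ 0 := by exact_mod_cast hM.ne'
  by_contra! H
  -- The product of these factors over u is the uniform weight of a colouring if it avoids colour m
  -- on A v, and 0 otherwise. If every colouring failed, the union bound would give 1 ≤ |V| M β.
  let w : V → Fin M → U → Fin M → ℝ := fun v m u x => if u ∈ A v ∧ x = m then 0 else 1 / (M : ℝ)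
  have hw0 : ∀ v m u x, 0 ≤ w v m u x := by
    intro v m u x
    simp only [w]
    split_ifs <;> positivity
  have hsum : ∀ v m, ∑ f : U → Fin M, ∏ u, w v m u (f u) = (1 - 1 / (M : ℝ)) ^ (A v).card := by
    intro v m
    have h1 : ∀ u, ∑ x, w v m u x = if u ∈ A v then 1 - 1 / (M : ℝ) else 1 := by
      intro u
      by_cases hu : u ∈ A v
      · have : ∀ x, w v m u x = 1 / (M : ℝ) - if x = m then 1 / (M : ℝ) else 0 := by
          intro x
          by_cases hx : x = m <;> simp [w, hu, hx]
        simp only [this, Finset.sum_sub_distrib, hu, if_true]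
        simp [hM']
      · simp [w, hu, hM']
    rw [sum_prod_pi]
    simp only [h1]
    rw [Finset.prod_ite, Finset.prod_const, Finset.prod_const_one, mul_one,
      Finset.filter_mem_eq_inter, Finset.univ_inter]
  have htot : ∑ _f : U → Fin M, ∏ _u : U, 1 / (M : ℝ) = 1 := by
    rw [sum_prod_pi fun _ _ => 1 / (M : ℝ)]
    simp [hM']
  have hle : ∀ f : U → Fin M, ∏ _u : U, 1 / (M : ℝ) ≤
      ∑ v ∈ Finset.univ.filter S, ∑ m, ∏ u, w v m u (f u) := by
    intro f
    obtain ⟨v, hv, m, hm⟩ := H f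
    have h1 : ∏ _u : U, 1 / (M : ℝ) = ∏ u, w v m u (f u) := by
      refine Finset.prod_congr rfl fun u _ => ?_
      simp only [w]
      rw [if_neg]
      rintro ⟨hu, hx⟩
      exact hm u hu hx
    rw [h1]
    have hp : ∀ v m, 0 ≤ ∏ u, w v m u (f u) := fun v m => Finset.prod_nonneg fun u _ => hw0 _ _ _ _
    exact (Finset.single_le_sum (f := fun m => ∏ u, w v m u (f u)) (fun m _ => hp v m)
      (Finset.mem_univ m)).trans (Finset.single_le_sum
        (f := fun v => ∑ m, ∏ u, w v m u (f u))
        (fun v _ => Finset.sum_nonneg fun m _ => hp v m) (by simpa using hv))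
  have h2 := Finset.sum_le_sum fun f (_ : f ∈ Finset.univ) => hle f
  rw [htot, Finset.sum_comm] at h2
  have h3 : ∑ v ∈ Finset.univ.filter S, ∑ f : U → Fin M, ∑ m, ∏ u, w v m u (f u) ≤
      Fintype.card V * (M * β) := by
    calc _ ≤ ∑ v ∈ Finset.univ.filter S, (M * β) := by
          refine Finset.sum_le_sum fun v hv => ?_
          rw [Finset.sum_comm]
          simp only [hsum]
          rw [Finset.sum_const, Finset.card_univ, Fintype.card_fin, nsmul_eq_mul]
          exact mul_le_mul_of_nonneg_left (hA v (Finset.mem_filter.mp hv).2) (Nat.cast_nonneg _)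
      _ ≤ _ := by
          rw [Finset.sum_const, nsmul_eq_mul]
          refine mul_le_mul_of_nonneg_right ?_ (by positivity)
          exact_mod_cast Finset.card_le_univ _
  linarith

theorem eventually_linear_lt_exp (c d : ℝ) {γ : ℝ} (hγ : 0 < γ) :
    ∀ᶠ n : ℕ in Filter.atTop, n * c + d < 1 / 4 * Real.exp (n * γ) := by
  filter_upwards [Filter.eventually_ge_atTop 1,
    Filter.eventually_ge_atTop ⌈8 * (|c| + |d| + 1) / γ ^ 2⌉₊] with n hn hn'
  have h1 : (1 : ℝ) ≤ n := by exact_mod_cast hn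
  have h2 : 8 * (|c| + |d| + 1) / γ ^ 2 ≤ n := Nat.ceil_le.mp hn'
  rw [div_le_iff₀ (by positivity)] at h2
  have h3 := Real.quadratic_le_exp_of_nonneg (show 0 ≤ n * γ by positivity)
  have h4 : n * (8 * (|c| + |d| + 1)) ≤ n * (n * γ ^ 2) :=
    mul_le_mul_of_nonneg_left h2 (by linarith)
  have h5 : n * c ≤ n * |c| := mul_le_mul_of_nonneg_left (le_abs_self c) (by linarith)
  have h6 : d ≤ n * |d| := (le_abs_self d).trans (le_mul_of_one_le_left (abs_nonneg d) h1)
  have h7 : 0 < n * γ := by positivity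
  nlinarith

theorem eventually_one_div_le (c : ℝ) (hc : 0 < c) {η : ℝ} (hη : 0 < η) :
    ∀ᶠ n : ℕ in Filter.atTop, 1 / (c * n) ≤ η := by
  filter_upwards [Filter.eventually_ge_atTop 1,
    Filter.eventually_ge_atTop ⌈1 / (c * η)⌉₊] with n hn hn'
  have h1 : (0 : ℝ) < n := by exact_mod_cast hn
  have h2 : 1 / (c * η) ≤ n := Nat.ceil_le.mp hn'
  rw [div_le_iff₀ (by positivity)] at h2 ⊢
  linarith

/-- The exponential rate, in nats, of the number of messages that can be stored. -/
noncomputable def exponent (x : ℝ × ℝ) (a b : ℝ) : ℝ :=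
  x.1 * Real.binEntropy a + x.2 * Real.binEntropy b

/-- Under independent programming with the prescribed probabilities, balanced admissible words carry
weight at least 1/2, while each carries exponentially little; hence there are many. -/
theorem exists_many_balanced {n : ℕ} (hn : 0 < n) {x : ℝ × ℝ} {a b δ γ : ℝ}
    (ha : a ∈ Set.Icc (0 : ℝ) (1 / 2)) (hb : b ∈ Set.Icc (0 : ℝ) (1 / 2)) (hδ : 0 < δ)
    (hδγ : δ * (slope a + slope b + 2) ≤ γ) (hnδ : 1 / (2 * δ ^ 2 * n) ≤ 1 / 2)
    {v : Count n 2} (hv : Typical x δ v) :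
    ∃ A : Finset (State n), (∀ c ∈ A, Balanced a b δ v c ∧ Admissible v c) ∧
      1 / 2 * Real.exp (n * (exponent x a b - γ)) ≤ A.card := by
  classical
  have hsub : Set.Icc (0 : ℝ) (1 / 2) ⊆ Set.Icc 0 1 := Set.Icc_subset_Icc_right (by norm_num)
  -- Frozen cells get probability 0, so inadmissible words have weight 0.
  let r : Fin n → ℝ := fun k => if v k = 0 then a else if v k = 1 then b else 0
  have hr : ∀ k, r k ∈ Set.Icc (0 : ℝ) 1 := by
    intro k
    simp only [r]
    split_ifs
    · exact hsub ha
    · exact hsub hb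
    · norm_num
  have h0 : ∀ k ∈ cells v 0, r k = a := fun k hk => by
    simp [r, (Finset.mem_filter.mp hk).2]
  have h1 : ∀ k ∈ cells v 1, r k = b := fun k hk => by
    simp [r, (Finset.mem_filter.mp hk).2]
  have h2 : ∀ k, v k = 2 → r k = 0 := fun k hk => by simp [r, hk]
  let A : Finset (State n) := Finset.univ.filter fun c => Balanced a b δ v c ∧ Admissible v c
  refine ⟨A, fun c hc => (Finset.mem_filter.mp hc).2, ?_⟩
  have hna : ∀ c, ¬ Admissible v c → wordWeight r (parity v) c = 0 := by
    intro c hc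
    unfold Admissible at hc
    push Not at hc
    obtain ⟨k, hk⟩ := hc
    refine Finset.prod_eq_zero (Finset.mem_univ k) ?_
    split_ifs at hk ⊢ with e
    · omega
    · refine h2 k (Fin.ext ?_)
      change (v k : ℕ) = 2
      omega
  have hhalf : 1 / 2 ≤ ∑ c ∈ A, wordWeight r (parity v) c := by
    have e1 := Finset.sum_filter_add_sum_filter_not Finset.univ
      (fun c => Balanced a b δ v c ∧ Admissible v c) (wordWeight r (parity v))
    rw [sum_wordWeight] at e1
    have e2 : ∑ c with ¬ (Balanced a b δ v c ∧ Admissible v c), wordWeight r (parity v) c ≤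
        ∑ c with ¬ Balanced a b δ v c, wordWeight r (parity v) c := by
      rw [Finset.sum_filter, Finset.sum_filter]
      refine Finset.sum_le_sum fun c _ => ?_
      have := wordWeight_nonneg (parity v) hr c
      by_cases hB : Balanced a b δ v c <;> by_cases hAd : Admissible v c <;> simp [hB, hAd, hna]
    have e3 := sum_wordWeight_not_balanced_le v hr h0 h1 (hsub ha) (hsub hb) hδ hn
    linarith
  have hle : ∀ c ∈ A, wordWeight r (parity v) c ≤
      Real.exp (-(n * (exponent x a b - γ))) := by
    intro c hc
    obtain ⟨hB, -⟩ := (Finset.mem_filter.mp hc).2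
    have hfac : ∀ k, 0 ≤ (if c k = parity v k then 1 - r k else r k) ∧
        (if c k = parity v k then 1 - r k else r k) ≤ 1 := by
      intro k
      have := hr k
      split_ifs
      · exact ⟨by linarith [this.2], by linarith [this.1]⟩
      · exact this
    rw [wordWeight, ← Finset.prod_filter_mul_prod_filter_not Finset.univ fun k => v k ≠ 2]
    refine (mul_le_of_le_one_right (Finset.prod_nonneg fun k _ => (hfac k).1)
      (Finset.prod_le_one (fun k _ => (hfac k).1) fun k _ => (hfac k).2)).trans ?_
    refine (hB.prod_flip_le hv h0 h1 hr ha hb).trans (Real.exp_le_exp.mpr ?_)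
    have := mul_le_mul_of_nonneg_left hδγ (Nat.cast_nonneg (α := ℝ) n)
    unfold exponent
    linarith
  have h3 := hhalf.trans (Finset.sum_le_sum hle)
  rw [Finset.sum_const, nsmul_eq_mul, Real.exp_neg, ← div_eq_mul_inv,
    le_div_iff₀ (Real.exp_pos _)] at h3
  exact h3

/-- One write without errors: a decoder that knows nothing, and an encoder that keeps the numbers
of cells with a given program count under control. -/
theorem eventually_exists_zero_error_write {x : ℝ × ℝ} {a b δ γ : ℝ}
    (ha : a ∈ Set.Icc (0 : ℝ) (1 / 2)) (hb : b ∈ Set.Icc (0 : ℝ) (1 / 2)) (hδ : 0 < δ)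
    (hγ : 0 < γ) (hδγ : δ * (slope a + slope b + 2) ≤ γ) :
    ∀ᶠ n : ℕ in Filter.atTop,
      ∃ (e : Fin ⌈Real.exp (n * (exponent x a b - 2 * γ))⌉₊ → Count n 2 → State n)
        (d : State n → Fin ⌈Real.exp (n * (exponent x a b - 2 * γ))⌉₊),
        ∀ m v, Admissible v (e m v) ∧ (Typical x δ v → d (e m v) = m ∧
          Typical (x.1 * (1 - a), x.2 * (1 - b) + x.1 * a) (4 * δ) (newCount v (e m v))) := by
  classical
  have hsub : Set.Icc (0 : ℝ) (1 / 2) ⊆ Set.Icc 0 1 := Set.Icc_subset_Icc_right (by norm_num)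
  filter_upwards [Filter.eventually_gt_atTop 0,
    eventually_one_div_le (2 * δ ^ 2) (by positivity) (show (0 : ℝ) < 1 / 2 by norm_num),
    eventually_linear_lt_exp (Real.log 3 + (exponent x a b - 2 * γ)) 1 hγ] with n hn hnδ hexp
  generalize hMdef : ⌈Real.exp (n * (exponent x a b - 2 * γ))⌉₊ = M
  have hM0 : 0 < M := hMdef ▸ Nat.ceil_pos.mpr (Real.exp_pos _)
  have hM0' : (0 : ℝ) < M := by exact_mod_cast hM0
  have hMlt : (M : ℝ) < Real.exp (n * (exponent x a b - 2 * γ)) + 1 :=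
    hMdef ▸ Nat.ceil_lt_add_one (Real.exp_pos _).le
  have hex : ∀ v : Count n 2, ∃ A : Finset (State n), Typical x δ v →
      (∀ c ∈ A, Balanced a b δ v c ∧ Admissible v c) ∧
      1 / 2 * Real.exp (n * (exponent x a b - γ)) ≤ A.card := by
    intro v
    by_cases hv : Typical x δ v
    · obtain ⟨A, hA⟩ := exists_many_balanced hn ha hb hδ hδγ hnδ hv
      exact ⟨A, fun _ => hA⟩
    · exact ⟨∅, fun h => absurd h hv⟩
  choose A hA using hex
  obtain ⟨f, hf⟩ : ∃ f : State n → Fin M, ∀ v, Typical x δ v → ∀ m, ∃ u ∈ A v, f u = m := by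
    -- For M = 1 nonempty sets suffice. For M ≥ 2 the ceiling at most doubles the exponential, and a
    -- colour is missed with doubly exponentially small probability, which beats the 3 ^ n count
    -- vectors and the M colours. One γ is lost to typicality, the other to the colouring.
    rcases (show M = 1 ∨ 2 ≤ M by omega) with h1 | h2
    · refine exists_coloring A _ hM0 le_rfl (fun v hv => ?_) (by simp)
      have h3 : (A v).card ≠ 0 := by
        intro h0
        have := (hA v hv).2
        rw [h0] at this
        have := Real.exp_pos (n * (exponent x a b - γ))
        push_cast at *
        linarith
      simp [h1, h3]
    · have h2' : (2 : ℝ) ≤ M := by exact_mod_cast h2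
      have hM2 : (M : ℝ) ≤ 2 * Real.exp (n * (exponent x a b - 2 * γ)) := by linarith
      refine exists_coloring A _ hM0 (Real.exp_pos (-(1 / 4 * Real.exp (n * γ)))).le
        (fun v hv => ?_) ?_
      · have h3 := (hA v hv).2
        have h4 : 1 - 1 / (M : ℝ) ≤ Real.exp (-(1 / (M : ℝ))) := by
          have := Real.add_one_le_exp (-(1 / (M : ℝ)))
          linarith
        have h5 : 0 ≤ 1 - 1 / (M : ℝ) := by
          rw [sub_nonneg, div_le_one hM0']
          linarith
        refine (pow_le_pow_left₀ h5 h4 _).trans ?_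
        rw [← Real.exp_nat_mul, Real.exp_le_exp, mul_neg, neg_le_neg_iff, mul_one_div,
          le_div_iff₀ hM0']
        refine le_trans ?_ h3
        calc 1 / 4 * Real.exp (n * γ) * M
            ≤ 1 / 4 * Real.exp (n * γ) * (2 * Real.exp (n * (exponent x a b - 2 * γ))) :=
              mul_le_mul_of_nonneg_left hM2 (by positivity)
          _ = 1 / 2 * (Real.exp (n * γ) * Real.exp (n * (exponent x a b - 2 * γ))) := by ring
          _ = _ := by
            rw [← Real.exp_add]
            congr 2
            ring
      · have h3 : (Fintype.card (Count n 2) : ℝ) = Real.exp (n * Real.log 3) := by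
          rw [Real.exp_nat_mul, Real.exp_log (by norm_num)]
          simp
        have h4 : (2 : ℝ) ≤ Real.exp 1 := by linarith [Real.add_one_le_exp (1 : ℝ)]
        rw [h3]
        calc _ ≤ Real.exp (n * Real.log 3) * ((Real.exp 1 *
              Real.exp (n * (exponent x a b - 2 * γ))) *
              Real.exp (-(1 / 4 * Real.exp (n * γ)))) := by
              have h5 := hM2.trans (mul_le_mul_of_nonneg_right h4
                (Real.exp_pos (n * (exponent x a b - 2 * γ))).le)
              gcongr
          _ = Real.exp (n * (Real.log 3 + (exponent x a b - 2 * γ)) + 1 -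
              1 / 4 * Real.exp (n * γ)) := by
              rw [← Real.exp_add, ← Real.exp_add, ← Real.exp_add]
              congr 1
              ring
          _ < 1 := (Real.exp_lt_exp.mpr (by linarith)).trans_eq Real.exp_zero
  have hex2 : ∀ (m : Fin M) (v : Count n 2), ∃ c : State n, Admissible v c ∧
      (Typical x δ v → f c = m ∧
        Typical (x.1 * (1 - a), x.2 * (1 - b) + x.1 * a) (4 * δ) (newCount v c)) := by
    intro m v
    by_cases hv : Typical x δ v
    · obtain ⟨c, hc, hfc⟩ := hf v hv m
      obtain ⟨h3, h4⟩ := (hA v hv).1 _ hc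
      exact ⟨c, h4, fun _ => ⟨hfc, hv.newCount h3 (hsub ha) (hsub hb)⟩⟩
    -- Off the typical vectors nothing is programmed, which is always admissible.
    · refine ⟨parity v, fun k => ?_, fun h => absurd h hv⟩
      simpa using Nat.le_of_lt_succ (v k).isLt
  choose e he using hex2
  exact ⟨e, f, he⟩

/-- The tolerance grows by the factor 4 on each write, so it must start small enough for all t
writes. -/
theorem exists_tolerance (t : ℕ) (B : ℕ → ℝ) {γ : ℝ} (hγ : 0 < γ) :
    ∃ δ : ℝ, 0 < δ ∧ ∀ j : Fin t, 4 ^ (j : ℕ) * δ * B j ≤ γ := by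
  have h1 : ∀ j : Fin t, ∀ᶠ δ : ℝ in nhdsWithin 0 (Set.Ioi 0), 4 ^ (j : ℕ) * δ * B j ≤ γ := by
    intro j
    have : Filter.Tendsto (fun δ : ℝ => 4 ^ (j : ℕ) * δ * B j) (nhds 0) (nhds 0) := by
      have : Continuous fun δ : ℝ => 4 ^ (j : ℕ) * δ * B j := by fun_prop
      simpa using this.tendsto 0
    exact ((this.eventually_le_const hγ)).filter_mono nhdsWithin_le_nhds
  obtain ⟨δ, h2, h3⟩ := ((Filter.eventually_all.mpr h1).and self_mem_nhdsWithin).exists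
  exact ⟨δ, h3, h2⟩

theorem rate_sub_le {n : ℕ} (hn : 0 < n) (a b : ℕ → ℝ) (j : ℕ) (γ : ℝ) :
    rate a b j - 2 * γ / Real.log 2 ≤
      Real.logb 2 ⌈Real.exp (n * (exponent (fresh a b j) (a j) (b j) - 2 * γ))⌉₊ / n := by
  have hn' : (0 : ℝ) < n := by exact_mod_cast hn
  have hl2 : 0 < Real.log 2 := Real.log_pos (by norm_num)
  have h1 := Real.log_le_log (Real.exp_pos _)
    (Nat.le_ceil (Real.exp (n * (exponent (fresh a b j) (a j) (b j) - 2 * γ))))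
  rw [Real.log_exp] at h1
  have h2 : rate a b j - 2 * γ / Real.log 2 =
      n * (exponent (fresh a b j) (a j) (b j) - 2 * γ) / Real.log 2 / n := by
    rw [rate, exponent, h, h]
    field_simp
  rw [h2, Real.logb]
  gcongr

theorem rateRegion_subset_zeroCapacity (Y : Knowledge) (t : ℕ) :
    rateRegion t ⊆ zeroCapacity Knowledge.IA Y t 2 := by
  rintro R ⟨a, b, ha, hb, hR⟩ ε hε
  have hl2 : 0 < Real.log 2 := Real.log_pos (by norm_num)
  -- A loss of 2γ nats per cell is a loss of ε bits.
  obtain ⟨γ, hγ⟩ : ∃ γ, γ = ε * Real.log 2 / 2 := ⟨_, rfl⟩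
  have hγ0 : 0 < γ := by rw [hγ]; positivity
  obtain ⟨δ, hδ, hδγ⟩ := exists_tolerance t (fun j => slope (a j) + slope (b j) + 2) hγ0
  have hev := Filter.eventually_all.mpr fun j : Fin t =>
    eventually_exists_zero_error_write (x := fresh a b j) (ha j) (hb j)
      (show 0 < 4 ^ (j : ℕ) * δ by positivity) hγ0 (hδγ j)
  obtain ⟨n, hn, H⟩ := ((Filter.eventually_gt_atTop 0).and hev).exists
  choose e d H using H
  let C : Code Knowledge.IA Y n t 2 _ :=
    { enc := e
      dec := fun j y _ => d j y
      admissible := fun _ j m v _ => (H j m v).1 }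
  -- Typicality never fails with positive probability, and on typical vectors decoding is always
  -- correct.
  have htyp : ∀ (j : Fin (t + 1)) (v : Count n 2), stateProb C.enc j v ≠ 0 →
      Typical (fresh a b j) (4 ^ (j : ℕ) * δ) v := by
    intro j
    induction j using Fin.induction with
    | zero =>
      intro v hv
      rw [stateProb_zero, ite_ne_right_iff] at hv
      rw [hv.1]
      exact typical_zero (by simpa using hδ.le)
    | succ j ih =>
      intro w hw
      rw [stateProb_succ] at hw
      obtain ⟨m, -, hm⟩ := Finset.exists_ne_zero_of_sum_ne_zero hw
      obtain ⟨v, -, hv⟩ := Finset.exists_ne_zero_of_sum_ne_zero hm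
      rw [ite_ne_right_iff] at hv
      obtain ⟨rfl, hv⟩ := hv
      have := ((H j m v).2 (ih v (right_ne_zero_of_mul hv))).2
      rw [← mul_assoc, ← pow_succ'] at this
      exact this
  refine ⟨n, _, C, hn, fun j => ⟨?_, ?_⟩⟩
  · rw [C.errorProb_eq]
    refine Finset.sum_eq_zero fun v _ => ?_
    by_cases hv : stateProb C.enc j.castSucc v = 0
    · rw [hv, zero_mul]
    · have h1 : ∀ m, C.dec j (newState v (C.enc j m (view Knowledge.IA v))) (view Y v) = m := by
        intro m
        obtain ⟨h2, h3⟩ := H j m v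
        have h4 := (h3 (htyp _ v hv)).1
        simpa only [C, view, newState_eq_of_admissible h2] using h4
      simp [h1]
  · refine le_trans ?_ (rate_sub_le hn a b j γ)
    have : 2 * γ / Real.log 2 = ε := by
      rw [hγ]
      field_simp
    rw [this]
    exact sub_le_sub_right (hR j) ε

/-! ### Random codebooks for an encoder that sees only the states -/

theorem exists_le_weighted_sum {ι : Type*} [Fintype ι] {w : ι → ℝ} (hw : ∀ i, 0 ≤ w i)
    (hw1 : ∑ i, w i = 1) (F : ι → ℝ) : ∃ i, F i ≤ ∑ j, w j * F j := by
  by_contra! H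
  have h0 : ∑ i, w i * (F i - ∑ j, w j * F j) = 0 := by
    simp only [mul_sub, Finset.sum_sub_distrib, ← Finset.sum_mul, hw1, one_mul, sub_self]
  rw [Finset.sum_eq_zero_iff_of_nonneg
    fun i _ => mul_nonneg (hw i) (sub_nonneg.mpr (H i).le)] at h0
  have h1 : ∀ i, w i = 0 := fun i =>
    (mul_eq_zero.mp (h0 i (Finset.mem_univ i))).resolve_right (sub_ne_zero.mpr (H i).ne')
  simp [h1] at hw1

section codebook

variable {n : ℕ}

/-- A collision forces agreement on the live cells only; each frozen cell is summed out with total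
weight 1. -/
theorem sum_wordWeight_collision_le {r : Fin n → ℝ} (v : Count n 2) (x : State n) :
    ∑ y with newState v y = newState v x, wordWeight r (parity v) y =
      ∏ k with v k ≠ 2, (if x k = parity v k then 1 - r k else r k) := by
  have h1 : ∀ y : State n, (if newState v y = newState v x then wordWeight r (parity v) y else 0) =
      ∏ k, if v k = 2 ∨ y k = x k then (if y k = parity v k then 1 - r k else r k) else 0 := by
    intro y
    have h2 : ∀ k, newState v y k = newState v x k ↔ v k = 2 ∨ y k = x k := by
      intro k
      have e : (v k = 2) ↔ (v k : ℕ) = 2 := Fin.ext_iff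
      have := (v k).isLt
      simp only [newState]
      split_ifs with h
      · have : ¬ v k = 2 := by rw [e]; omega
        simp [this]
      · have : v k = 2 := by rw [e]; omega
        simp [this]
    split_ifs with h
    · refine Finset.prod_congr rfl fun k _ => ?_
      rw [if_pos ((h2 k).mp (congrFun h k))]
    · obtain ⟨k, hk⟩ := Function.ne_iff.mp h
      exact (Finset.prod_eq_zero (Finset.mem_univ k) (if_neg (mt (h2 k).mpr hk))).symm
  rw [Finset.sum_filter, Finset.sum_congr rfl fun y _ => h1 y,
    sum_prod_pi fun k z => if v k = 2 ∨ z = x k then (if z = parity v k then 1 - r k else r k)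
      else 0, Finset.prod_filter]
  refine Finset.prod_congr rfl fun k _ => ?_
  by_cases hk : v k = 2
  · simp only [hk, true_or, if_true, ne_eq, not_true_eq_false, if_false]
    exact sum_flip _ _
  · simp [hk]

open Classical in
/-- The indicator of the event that message `m` is not safe: its codeword is not balanced, or
another codeword leads to the same memory state. -/
noncomputable def failure (a b δ : ℝ) {M : ℕ} (v : Count n 2) (c : Fin M → State n) (m : Fin M) :
    ℝ :=
  if Balanced a b δ v (c m) ∧ ∀ m', m' ≠ m → newState v (c m') ≠ newState v (c m) then 0 else 1

theorem failure_nonneg (a b δ : ℝ) {M : ℕ} (v : Count n 2) (c : Fin M → State n) (m : Fin M) :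
    0 ≤ failure a b δ v c m := by
  unfold failure
  split_ifs <;> norm_num

open Classical in
theorem failure_le (a b δ : ℝ) {M : ℕ} (v : Count n 2) (c : Fin M → State n) (m : Fin M) :
    failure a b δ v c m ≤ (if ¬ Balanced a b δ v (c m) then 1 else 0) +
      ∑ m' ∈ Finset.univ.erase m,
        if Balanced a b δ v (c m) ∧ newState v (c m') = newState v (c m) then 1 else 0 := by
  have hnn : ∀ m' ∈ Finset.univ.erase m, (0 : ℝ) ≤
      if Balanced a b δ v (c m) ∧ newState v (c m') = newState v (c m) then 1 else 0 := by
    intro m' _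
    split_ifs <;> norm_num
  have hsum := Finset.sum_nonneg hnn
  unfold failure
  by_cases hB : Balanced a b δ v (c m)
  · by_cases hm : ∀ m', m' ≠ m → newState v (c m') ≠ newState v (c m)
    · rw [if_pos ⟨hB, hm⟩, if_neg (not_not.mpr hB), zero_add]
      exact hsum
    · rw [if_neg (fun h => hm h.2), if_neg (not_not.mpr hB), zero_add]
      push Not at hm
      obtain ⟨m', h1, h2⟩ := hm
      refine le_trans ?_ (Finset.single_le_sum hnn
        (Finset.mem_erase.mpr ⟨h1, Finset.mem_univ m'⟩))
      rw [if_pos ⟨hB, h2⟩]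
  · rw [if_neg (fun h => hB h.1), if_pos hB]
    linarith

/-- The programming probability depends on the state alone, so frozen cells are treated like fresh
ones; they affect neither balancedness nor collisions. The first term bounds unbalanced codewords by
Chebyshev, the second is a union bound over the other messages. -/
theorem sum_codebook_mul_failure_le (hn : 0 < n) {x : ℝ × ℝ} {a b δ γ : ℝ}
    (ha : a ∈ Set.Icc (0 : ℝ) (1 / 2)) (hb : b ∈ Set.Icc (0 : ℝ) (1 / 2)) (hδ : 0 < δ)
    (hδγ : δ * (slope a + slope b + 2) ≤ γ) {v : Count n 2} (hv : Typical x δ v) {M : ℕ}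
    (m : Fin M) :
    ∑ c : Fin M → State n,
      (∏ m, wordWeight (fun k => if parity v k = 0 then a else b) (parity v) (c m)) *
        failure a b δ v c m ≤
      1 / (2 * δ ^ 2 * n) + (M - 1) * Real.exp (-(n * (exponent x a b - γ))) := by
  classical
  have hsub : Set.Icc (0 : ℝ) (1 / 2) ⊆ Set.Icc 0 1 := Set.Icc_subset_Icc_right (by norm_num)
  obtain ⟨r, hrdef⟩ : ∃ r : Fin n → ℝ, r = fun k => if parity v k = 0 then a else b := ⟨_, rfl⟩
  rw [← hrdef]
  have hr : ∀ k, r k ∈ Set.Icc (0 : ℝ) 1 := by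
    intro k
    simp only [hrdef]
    split_ifs
    · exact hsub ha
    · exact hsub hb
  have h0 : ∀ k ∈ cells v 0, r k = a := fun k hk => by
    simp [hrdef, parity, (Finset.mem_filter.mp hk).2]
  have h1 : ∀ k ∈ cells v 1, r k = b := fun k hk => by
    simp [hrdef, parity, (Finset.mem_filter.mp hk).2]
  have hw0 := wordWeight_nonneg (parity v) hr
  have hw1 := sum_wordWeight (r := r) (parity v)
  have hW0 : ∀ c : Fin M → State n, 0 ≤ ∏ m, wordWeight r (parity v) (c m) := fun c =>
    Finset.prod_nonneg fun _ _ => hw0 _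
  have hfirst : ∑ c : Fin M → State n, (∏ m, wordWeight r (parity v) (c m)) *
      (if ¬ Balanced a b δ v (c m) then 1 else 0) ≤ 1 / (2 * δ ^ 2 * n) := by
    rw [sum_prod_pi_mul (f := fun _ => wordWeight r (parity v)) (fun _ => hw1) m
      fun y => if ¬ Balanced a b δ v y then 1 else 0]
    simp only [mul_ite, mul_one, mul_zero]
    rw [← Finset.sum_filter]
    exact sum_wordWeight_not_balanced_le v hr h0 h1 (hsub ha) (hsub hb) hδ hn
  have hpair : ∀ m' ∈ Finset.univ.erase m,
      ∑ c : Fin M → State n, (∏ m, wordWeight r (parity v) (c m)) *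
        (if Balanced a b δ v (c m) ∧ newState v (c m') = newState v (c m) then 1 else 0) ≤
      Real.exp (-(n * (exponent x a b - γ))) := by
    intro m' hm'
    have hne : m ≠ m' := (Finset.ne_of_mem_erase hm').symm
    -- Splitting by the value y of the codeword of m lets independence of the two codewords be used.
    have e1 : ∀ c : Fin M → State n,
        (if Balanced a b δ v (c m) ∧ newState v (c m') = newState v (c m) then (1 : ℝ) else 0) =
        ∑ y, (if c m = y then (if Balanced a b δ v y then (1 : ℝ) else 0) else 0) *
          (if newState v (c m') = newState v y then 1 else 0) := by
      intro c
      simp only [ite_mul, zero_mul, Finset.sum_ite_eq, Finset.mem_univ, if_true, one_mul, ite_and]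
    simp only [e1, Finset.mul_sum]
    rw [Finset.sum_comm]
    have e2 : ∀ y, ∑ c : Fin M → State n, (∏ m, wordWeight r (parity v) (c m)) *
        ((if c m = y then (if Balanced a b δ v y then (1 : ℝ) else 0) else 0) *
          (if newState v (c m') = newState v y then 1 else 0)) ≤
        wordWeight r (parity v) y * Real.exp (-(n * (exponent x a b - γ))) := by
      intro y
      rw [sum_prod_pi_mul_mul (f := fun _ => wordWeight r (parity v)) (fun _ => hw1) hne
        (fun z => if z = y then (if Balanced a b δ v y then (1 : ℝ) else 0) else 0)
        (fun z => if newState v z = newState v y then 1 else 0)]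
      simp only [mul_ite, mul_one, mul_zero, Finset.sum_ite_eq', Finset.mem_univ, if_true]
      rw [← Finset.sum_filter, sum_wordWeight_collision_le]
      split_ifs with hB
      · refine mul_le_mul_of_nonneg_left ?_ (hw0 y)
        refine (hB.prod_flip_le hv h0 h1 hr ha hb).trans (Real.exp_le_exp.mpr ?_)
        have := mul_le_mul_of_nonneg_left hδγ (Nat.cast_nonneg (α := ℝ) n)
        unfold exponent
        linarith
      · rw [zero_mul]
        exact mul_nonneg (hw0 y) (Real.exp_pos _).le
    refine (Finset.sum_le_sum fun y _ => e2 y).trans ?_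
    rw [← Finset.sum_mul, hw1, one_mul]
  calc _ ≤ ∑ c : Fin M → State n, ((∏ m, wordWeight r (parity v) (c m)) *
        (if ¬ Balanced a b δ v (c m) then 1 else 0) + ∑ m' ∈ Finset.univ.erase m,
        (∏ m, wordWeight r (parity v) (c m)) *
        (if Balanced a b δ v (c m) ∧ newState v (c m') = newState v (c m) then 1 else 0)) := by
        refine Finset.sum_le_sum fun c _ => ?_
        rw [← Finset.mul_sum, ← mul_add]
        exact mul_le_mul_of_nonneg_left (failure_le a b δ v c m) (hW0 c)
    _ ≤ _ := by
        rw [Finset.sum_add_distrib, Finset.sum_comm (t := Finset.univ.erase m)]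
        refine add_le_add hfirst ((Finset.sum_le_sum hpair).trans ?_)
        rw [Finset.sum_const, Finset.card_erase_of_mem (Finset.mem_univ m), Finset.card_univ,
          Fintype.card_fin, nsmul_eq_mul, Nat.cast_sub m.pos, Nat.cast_one]

open Classical in
/-- One write with a decoder that knows the program counts and an encoder that knows only the cell
states, for a random count vector with distribution `μ`. -/
theorem eventually_exists_small_error_write {x : ℝ × ℝ} {a b δ γ η : ℝ}
    (ha : a ∈ Set.Icc (0 : ℝ) (1 / 2)) (hb : b ∈ Set.Icc (0 : ℝ) (1 / 2)) (hδ : 0 < δ)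
    (hγ : 0 < γ) (hη : 0 < η) (hδγ : δ * (slope a + slope b + 2) ≤ γ) :
    ∀ᶠ n : ℕ in Filter.atTop, ∀ μ : Count n 2 → ℝ,
      ∃ (e : Fin ⌈Real.exp (n * (exponent x a b - 2 * γ))⌉₊ → State n → State n)
        (d : State n → Count n 2 → Fin ⌈Real.exp (n * (exponent x a b - 2 * γ))⌉₊),
        (∀ v, 0 ≤ μ v) →
        ∑ v, μ v * (1 / (⌈Real.exp (n * (exponent x a b - 2 * γ))⌉₊ : ℝ) * ∑ m,
          if d (newState v (e m (parity v))) v = m ∧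
            Typical (x.1 * (1 - a), x.2 * (1 - b) + x.1 * a) (4 * δ) (newCount v (e m (parity v)))
          then 0 else 1) ≤
        ∑ v, μ v * if Typical x δ v then η else 1 := by
  have hsub : Set.Icc (0 : ℝ) (1 / 2) ⊆ Set.Icc 0 1 := Set.Icc_subset_Icc_right (by norm_num)
  -- The length n is chosen before μ. This matters because μ will be the law produced by the
  -- encoders of the earlier writes.
  filter_upwards [Filter.eventually_gt_atTop 0,
    eventually_one_div_le (2 * δ ^ 2) (by positivity) (show 0 < η / 2 by positivity),
    eventually_one_div_le γ hγ (show 0 < η / 2 by positivity)] with n hn hnδ hnγ μ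
  have hn' : (0 : ℝ) < n := by exact_mod_cast hn
  have hMlt := Nat.ceil_lt_add_one (Real.exp_pos (n * (exponent x a b - 2 * γ))).le
  have hM0 : 0 < ⌈Real.exp (n * (exponent x a b - 2 * γ))⌉₊ := Nat.ceil_pos.mpr (Real.exp_pos _)
  generalize ⌈Real.exp (n * (exponent x a b - 2 * γ))⌉₊ = M at hMlt hM0 ⊢
  have hM0' : (0 : ℝ) < M := by exact_mod_cast hM0
  by_cases hμ : ∀ v, 0 ≤ μ v
  swap
  · exact ⟨fun _ s => s, fun _ _ => ⟨0, hM0⟩, fun h => absurd h hμ⟩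
  have hsmall : 1 / (2 * δ ^ 2 * n) + (M - 1) * Real.exp (-(n * (exponent x a b - γ))) ≤ η := by
    have h1 : (M - 1) * Real.exp (-(n * (exponent x a b - γ))) ≤ Real.exp (-(γ * n)) := by
      refine (mul_le_mul_of_nonneg_right (by linarith :
        (M : ℝ) - 1 ≤ Real.exp (n * (exponent x a b - 2 * γ))) (Real.exp_pos _).le).trans_eq ?_
      rw [← Real.exp_add]
      congr 1
      ring
    have h2 : Real.exp (-(γ * n)) ≤ 1 / (γ * n) := by
      rw [Real.exp_neg, ← one_div]
      exact one_div_le_one_div_of_le (by positivity) (by linarith [Real.add_one_le_exp (γ * n)])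
    linarith
  let r : State n → Fin n → ℝ := fun s k => if s k = 0 then a else b
  have hr : ∀ s k, r s k ∈ Set.Icc (0 : ℝ) 1 := by
    intro s k
    simp only [r]
    split_ifs
    · exact hsub ha
    · exact hsub hb
  let W : State n → (Fin M → State n) → ℝ := fun s c => ∏ m, wordWeight (r s) s (c m)
  have hW0 : ∀ s c, 0 ≤ W s c := fun s c =>
    Finset.prod_nonneg fun _ _ => wordWeight_nonneg s (hr s) _
  have hW1 : ∀ s, ∑ c, W s c = 1 := by
    intro s
    simp only [W]
    rw [sum_prod_pi fun _ y => wordWeight (r s) s y]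
    exact Finset.prod_eq_one fun _ _ => sum_wordWeight s
  let g : Count n 2 → (Fin M → State n) → Fin M → ℝ := fun v c m =>
    if Typical x δ v then failure a b δ v c m else 1
  have hg : ∀ v m, ∑ c, W (parity v) c * g v c m ≤ if Typical x δ v then η else 1 := by
    intro v m
    simp only [g]
    split_ifs with hv
    · exact (sum_codebook_mul_failure_le hn ha hb hδ hδγ hv m).trans hsmall
    · simp [hW1]
  -- For each state vector s a codebook is fixed that is at least as good as the average over the
  -- count vectors of parity s; this is all that the encoder can distinguish.
  choose c hc using fun s => exists_le_weighted_sum (hW0 s) (hW1 s) fun c =>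
    ∑ v with parity v = s, μ v * (1 / (M : ℝ) * ∑ m, g v c m)
  -- The decoder knows v, hence the codebook and the effect of every codeword; it picks any message
  -- that explains the observed state.
  refine ⟨fun m s => c s m, fun y v => if hy : ∃ m, newState v (c (parity v) m) = y then hy.choose
    else ⟨0, hM0⟩, fun _ => ?_⟩
  calc _ ≤ ∑ v, μ v * (1 / (M : ℝ) * ∑ m, g v (c (parity v)) m) := by
        refine Finset.sum_le_sum fun v _ => mul_le_mul_of_nonneg_left
          (mul_le_mul_of_nonneg_left (Finset.sum_le_sum fun m _ => ?_) (by positivity)) (hμ v)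
        have hy : ∃ m', newState v (c (parity v) m') = newState v (c (parity v) m) := ⟨m, rfl⟩
        simp only [g]
        rw [dif_pos hy]
        split_ifs with h1 hv hv
        · exact failure_nonneg _ _ _ _ _ _
        · exact zero_le_one' ℝ
        · rw [failure, if_neg]
          rintro ⟨hB, hm⟩
          refine h1 ⟨?_, hv.newCount hB (hsub ha) (hsub hb)⟩
          by_contra hne
          exact hm _ hne hy.choose_spec
        · exact le_rfl
    _ = ∑ s, ∑ v with parity v = s, μ v * (1 / (M : ℝ) * ∑ m, g v (c s) m) := by
        rw [← Finset.sum_fiberwise Finset.univ (fun v => parity v)]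
        refine Finset.sum_congr rfl fun s _ => Finset.sum_congr rfl fun v hv => ?_
        rw [(Finset.mem_filter.mp hv).2]
    _ ≤ ∑ s, ∑ v with parity v = s, μ v * if Typical x δ v then η else 1 := by
        refine Finset.sum_le_sum fun s _ => (hc s).trans ?_
        have e1 : ∀ v, ∑ c, W s c * (μ v * (1 / (M : ℝ) * ∑ m, g v c m)) =
            μ v * (1 / (M : ℝ) * ∑ m, ∑ c, W s c * g v c m) := by
          intro v
          rw [Finset.sum_comm]
          simp only [Finset.mul_sum]
          exact Finset.sum_congr rfl fun c _ => Finset.sum_congr rfl fun m _ => by ring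
        rw [Finset.sum_congr rfl fun c _ => Finset.mul_sum _ _ _, Finset.sum_comm]
        refine Finset.sum_le_sum fun v hv => ?_
        rw [e1, ← (Finset.mem_filter.mp hv).2]
        refine mul_le_mul_of_nonneg_left ?_ (hμ v)
        refine (mul_le_mul_of_nonneg_left (Finset.sum_le_sum fun m _ => hg v m)
          (by positivity)).trans_eq ?_
        exact one_div_mul_sum_const hM0 _
    _ = _ := Finset.sum_fiberwise Finset.univ (fun v => parity v) _

end codebook

theorem rateRegion_subset_epsCapacity (t : ℕ) :
    rateRegion t ⊆ epsCapacity Knowledge.IP Knowledge.IA t 2 := by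
  classical
  rintro R ⟨a, b, ha, hb, hR⟩ ε hε
  have hl2 : 0 < Real.log 2 := Real.log_pos (by norm_num)
  obtain ⟨γ, hγ⟩ : ∃ γ, γ = ε * Real.log 2 / 2 := ⟨_, rfl⟩
  have hγ0 : 0 < γ := by rw [hγ]; positivity
  -- Each write adds at most η to the probability of being atypical; with one more η for decoding
  -- errors, the total stays within (t + 1) η = ε.
  obtain ⟨η, hη⟩ : ∃ η, η = ε / (t + 1) := ⟨_, rfl⟩
  have hη0 : 0 < η := by rw [hη]; positivity
  obtain ⟨δ, hδ, hδγ⟩ := exists_tolerance t (fun j => slope (a j) + slope (b j) + 2) hγ0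
  have hev := Filter.eventually_all.mpr fun j : Fin t =>
    eventually_exists_small_error_write (x := fresh a b j) (ha j) (hb j)
      (show 0 < 4 ^ (j : ℕ) * δ by positivity) hγ0 hη0 (hδγ j)
  obtain ⟨n, hn, H⟩ := ((Filter.eventually_gt_atTop 0).and hev).exists
  clear hev
  choose e d H using H
  -- The laws and the encoders are built together: the encoder of each write is the one chosen for
  -- the law created by the previous writes. `hμ` then identifies these laws with those of the code.
  let μ : Fin (t + 1) → Count n 2 → ℝ :=
    Fin.induction (motive := fun _ => Count n 2 → ℝ) (fun v => if v = 0 then 1 else 0)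
      fun j P w => ∑ m, ∑ v, if newCount v (e j P m (parity v)) = w then
        1 / (⌈Real.exp (n * (exponent (fresh a b j) (a j) (b j) - 2 * γ))⌉₊ : ℝ) * P v else 0
  let C : Code Knowledge.IP Knowledge.IA n t 2 fun j =>
      ⌈Real.exp (n * (exponent (fresh a b j) (a j) (b j) - 2 * γ))⌉₊ :=
    { enc := fun j m s => e j (μ j.castSucc) m s
      dec := fun j y v => d j (μ j.castSucc) y v
      admissible := fun h => nomatch h }
  have hμ : ∀ j, stateProb C.enc j = μ j := by
    intro j
    induction j using Fin.induction with
    | zero => rfl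
    | succ j ih =>
      funext w
      simp only [stateProb_succ, μ]
      rw [Fin.induction_succ]
      refine Finset.sum_congr rfl fun m _ => Finset.sum_congr rfl fun v _ => ?_
      rw [ih]
      rfl
  have hcard := C.card_pos
  let bad : Fin (t + 1) → ℝ := fun j =>
    ∑ v, stateProb C.enc j v * if Typical (fresh a b j) (4 ^ (j : ℕ) * δ) v then 0 else 1
  have hstep : ∀ j : Fin t, ∑ v, stateProb C.enc j.castSucc v *
      (1 / (⌈Real.exp (n * (exponent (fresh a b j) (a j) (b j) - 2 * γ))⌉₊ : ℝ) * ∑ m,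
        if C.dec j (newState v (C.enc j m (parity v))) v = m ∧
          Typical (fresh a b (j + 1)) (4 ^ ((j : ℕ) + 1) * δ) (newCount v (C.enc j m (parity v)))
        then 0 else 1) ≤ bad j.castSucc + η := by
    intro j
    have h1 := H j (μ j.castSucc) (fun v => by rw [← hμ]; exact stateProb_nonneg _ _ _)
    rw [← mul_assoc, ← pow_succ'] at h1
    have h2 : ∑ v, μ j.castSucc v * (if Typical (fresh a b j) (4 ^ (j : ℕ) * δ) v then η else 1) ≤
        bad j.castSucc + η := by
      have h3 : η = ∑ v, stateProb C.enc j.castSucc v * η := by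
        rw [← Finset.sum_mul, sum_stateProb _ hcard, one_mul]
      conv_rhs => rw [h3]
      simp only [bad]
      rw [← Finset.sum_add_distrib, ← hμ]
      refine Finset.sum_le_sum fun v _ => ?_
      rw [← mul_add]
      refine mul_le_mul_of_nonneg_left ?_ (stateProb_nonneg _ _ _)
      rw [Fin.val_castSucc]
      split_ifs <;> linarith
    rw [hμ]
    exact h1.trans h2
  have hbad : ∀ j : Fin (t + 1), bad j ≤ (j : ℕ) * η := by
    intro j
    induction j using Fin.induction with
    | zero =>
      have h0 : Typical (fresh a b ((0 : Fin (t + 1)) : ℕ)) (4 ^ ((0 : Fin (t + 1)) : ℕ) * δ)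
          (0 : Count n 2) := by
        simpa [fresh] using typical_zero hδ.le
      refine (Finset.sum_eq_zero fun v _ => ?_).le.trans_eq (by simp)
      rw [stateProb_zero]
      by_cases hv : v = 0
      · rw [hv, if_pos h0, mul_zero]
      · rw [if_neg hv, zero_mul]
    | succ j ih =>
      refine le_trans ?_ ((hstep j).trans (show bad j.castSucc + η ≤ _ from ?_))
      · simp only [bad]
        rw [sum_stateProb_succ_mul]
        refine Finset.sum_le_sum fun v _ => mul_le_mul_of_nonneg_left
          (mul_le_mul_of_nonneg_left (Finset.sum_le_sum fun m _ => ?_) (by positivity))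
          (stateProb_nonneg _ _ _)
        rw [Fin.val_succ]
        change (if Typical _ _ (newCount v (C.enc j m (parity v))) then (0 : ℝ) else 1) ≤ _
        split_ifs with h1 h2 h2
        · exact le_rfl
        · exact zero_le_one' ℝ
        · exact absurd h2.2 h1
        · exact le_rfl
      · rw [Fin.val_castSucc] at ih
        rw [Fin.val_succ]
        push_cast
        linarith
  refine ⟨n, _, C, hn, fun j => ⟨?_, ?_⟩⟩
  · have h1 : C.errorProb j ≤ bad j.castSucc + η := by
      refine le_trans ?_ (hstep j)
      rw [C.errorProb_eq]
      refine Finset.sum_le_sum fun v _ => mul_le_mul_of_nonneg_left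
        (mul_le_mul_of_nonneg_left ?_ (by positivity)) (stateProb_nonneg _ _ _)
      rw [Finset.card_filter]
      push_cast
      refine Finset.sum_le_sum fun m _ => ?_
      change (if C.dec j (newState v (C.enc j m (parity v))) v ≠ m then (1 : ℝ) else 0) ≤ _
      split_ifs with h1 h2 h2
      · exact absurd h2.1 h1
      · exact le_rfl
      · exact le_rfl
      · exact zero_le_one' ℝ
    have h2 := hbad j.castSucc
    rw [Fin.val_castSucc] at h2
    have h3 : (j : ℕ) * η ≤ t * η :=
      mul_le_mul_of_nonneg_right (by exact_mod_cast j.isLt.le) hη0.le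
    have h4 : t * η + η = ε := by
      rw [hη]
      field_simp
    linarith
  · refine le_trans ?_ (rate_sub_le hn a b j γ)
    have : 2 * γ / Real.log 2 = ε := by
      rw [hγ]
      field_simp
    rw [this]
    exact sub_le_sub_right (hR j) ε

/-! ### Assembling the inclusions -/

theorem zeroCapacity_subset_epsCapacity (X Y : Knowledge) (t ℓ : ℕ) :
    zeroCapacity X Y t ℓ ⊆ epsCapacity X Y t ℓ := by
  intro R hR ε hε
  obtain ⟨n, M, C, hn, H⟩ := hR ε hε
  exact ⟨n, M, C, hn, fun j => ⟨(H j).1.le.trans hε.le, (H j).2⟩⟩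

end ELM

theorem mainTheorem9 (t : ℕ) :
    (∀ Y : ELM.Knowledge,
      ELM.epsCapacity ELM.Knowledge.IP ELM.Knowledge.IA t 2 =
          ELM.epsCapacity ELM.Knowledge.IA Y t 2 ∧
        ELM.epsCapacity ELM.Knowledge.IP ELM.Knowledge.IA t 2 =
          ELM.zeroCapacity ELM.Knowledge.IA Y t 2) ∧
      ELM.epsCapacity ELM.Knowledge.IP ELM.Knowledge.IA t 2 = ELM.regionEIA t 2 ∧
      ELM.regionEIPDIA t 2 = ELM.regionEIA t 2 := by
  have hIP : ELM.epsCapacity ELM.Knowledge.IP ELM.Knowledge.IA t 2 = ELM.rateRegion t :=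
    (ELM.epsCapacity_subset _ _ t).antisymm (ELM.rateRegion_subset_epsCapacity t)
  refine ⟨fun Y => ?_, hIP.trans (ELM.regionEIA_eq t).symm,
    (ELM.regionEIPDIA_eq t).trans (ELM.regionEIA_eq t).symm⟩
  have hz := ELM.rateRegion_subset_zeroCapacity Y t
  have hze := ELM.zeroCapacity_subset_epsCapacity ELM.Knowledge.IA Y t 2
  have he := ELM.epsCapacity_subset ELM.Knowledge.IA Y t
  exact ⟨hIP.trans ((hz.trans hze).antisymm he), hIP.trans (hz.antisymm (hze.trans he))⟩
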